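/- Let $K$ be a unital commutative $\mathbb{Q}$-algebra, let $z=(z_1,\dots,z_n)$ be either commutative or noncommutative free variables, and let $t$ be a central parameter. Write $K\langle\langle z\rangle\rangle$ and $K[[t]]\langle\langle z\rangle\rangle$ for the algebras of formal power series in $z$ over $K$ and over $K[[t]]$. For a tuple $a=(a_1,\dots,a_n)$ of such series let $[a\,\partial/\partial z]$ denote the derivation with $z_i\mapsto a_i$. A $K[[t]]$-linear operator $P$ on $K[[t]]\langle\langle z\rangle\rangle$ is identified with the series $\sum_{m\ge 0} t^m P_m$ of $K$-linear operators $P_m$ on $K\langle\langle z\rangle\rangle$, where $P_m u$ is the coefficient of $t^m$ in $Pu$ for $u \in K\langle\langle z\rangle\rangle$. Let $\alpha\ge 1$ and let $F_t$ be an automorphism of $K[[t]]\langle\langle z\rangle\rangle$ over $K[[t]]$ of the form $F_t(z)=z-H_t(z)$, where $H_t$ has order at least $\alpha$ in $z$ and $H_{t=0}=0$. Let $G_t(z)=z+M_t(z)$ be its inverse. Define sequences of operators $\lambda_m, s_m$ $(m\ge 0)$ and $\psi_m, \xi_m$ $(m\ge 1)$ on $K\langle\langle z\rangle\rangle$ by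 $$\sum_{m\ge 0} (-t)^m\lambda_m u = u(F_t),\qquad \sum_{m\ge 0} t^m s_m u = u(G_t)\qquad (u\in K\langle\langle z\rangle\rangle),$$ $$\sum_{m\ge 1} t^{m-1}\psi_m=\Big[\tfrac{\partial M_t}{\partial t}(F_t)\,\tfrac{\partial}{\partial z}\Big],\qquad \sum_{m\ge 1} t^{m-1}\xi_m=\Big[\tfrac{\partial H_t}{\partial t}(G_t)\,\tfrac{\partial}{\partial z}\Big].$$ The D-Log of $F_t$ is the tuple $a_t(z)\in \big(t\,K[[t]]\langle\langle z\rangle\rangle\big)^{n}$ such that $d(t):=-[a_t(z)\,\partial/\partial z]$ satisfies $e^{d(t)}u=u(G_t)$ for all $u\in K[[t]]\langle\langle z\rangle\rangle$. Let $\mathcal C$ be the set of compositions, i.e. non-empty finite sequences $I=(i_1,\dots,i_m)$ of positive integers. Write $\ell(I)=m$, $|I|=i_1+\dots+i_m$, $\bar I=(i_m,\dots,i_1)$, $w^I=w_{i_1}w_{i_2}\cdots w_{i_m}$ for a sequence of operators $w_1,w_2,\dots$, and $\pi_u(I)=\prod_{j=1}^m(i_1+\dots+i_j)$. Write $I\succeq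 J$ if $I$ is a refinement of $J$, that is, if $I$ can be cut into consecutive non-empty pieces $I_1,\dots,I_{\ell(J)}$ such that $|I_a|$ is the $a$-th part of $J$ for every $a$; in this case put $\pi_u(I,J)=\prod_a \pi_u(I_a)$. Then the D-Log $a_t(z)$ of $F_t$ exists, is unique, and is given by each of the following formulas: $$a_t(z)=\sum_{I\in\mathcal C}\frac{(-1)^{\ell(I)-|I|+1}}{\ell(I)}\,t^{|I|}\,\lambda^I z,$$ $$a_t(z)=\sum_{I\in\mathcal C}\frac{(-1)^{\ell(I)}}{\ell(I)}\,t^{|I|}\,s^I z,$$ $$a_t(z)=\sum_{I\in\mathcal C}\Big(\sum_{I\succeq J}\frac{(-1)^{\ell(J)}}{\pi_u(I,J)\,\ell(J)}\Big)t^{|I|}\,\psi^I z,$$ $$a_t(z)=\sum_{I\in\mathcal C}\Big(\sum_{I\succeq J}\frac{(-1)^{\ell(J)}}{\pi_u(\bar I,\bar J)\,\ell(J)}\Big)t^{|I|}\,\xi^I z.$$ -/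

import Mathlib

open scoped PowerSeries

universe u

noncomputable section

/-! ### Formal power series in noncommutative free variables -/

/-- Formal power series over `R` in noncommuting free variables indexed by `σ`: arbitrary
families of coefficients indexed by the words in `σ`. -/
def NCPowerSeries (σ : Type*) (R : Type*) : Type _ := List σ → R

namespace NCPowerSeries

instance {σ R : Type*} [AddCommGroup R] : AddCommGroup (NCPowerSeries σ R) :=
  inferInstanceAs (AddCommGroup (List σ → R))

instance {σ R : Type*} [CommRing R] : Module R (NCPowerSeries σ R) :=
  inferInstanceAs (Module R (List σ → R))

/-- The product: the coefficient of a word is the sum over all ways to cut the word in two. -/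
instance {σ R : Type*} [CommRing R] : Mul (NCPowerSeries σ R) where
  mul f g := fun w => ∑ k ∈ Finset.range (w.length + 1), f (w.take k) * g (w.drop k)

instance {σ R : Type*} [CommRing R] : One (NCPowerSeries σ R) where
  one := fun w => match w with
    | [] => 1
    | _ :: _ => 0

/-- The series formed by the words starting with `i`, with this first letter removed. -/
def tail {σ R : Type*} (i : σ) (f : NCPowerSeries σ R) : NCPowerSeries σ R := fun w => f (i :: w)

/-- The variable `i`. -/
def X {σ R : Type*} [DecidableEq σ] [CommRing R] (i : σ) : NCPowerSeries σ R :=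
  fun w => if w = [i] then 1 else 0

section facts

variable {σ R : Type*} [CommRing R]

theorem ext' {σ R : Type*} {f g : NCPowerSeries σ R} (h : ∀ w, f w = g w) : f = g := funext h

theorem add_apply (f g : NCPowerSeries σ R) (w : List σ) : (f + g) w = f w + g w := rfl

theorem zero_apply (w : List σ) : (0 : NCPowerSeries σ R) w = 0 := rfl

theorem smul_apply (r : R) (f : NCPowerSeries σ R) (w : List σ) : (r • f) w = r * f w := rfl

theorem mul_apply (f g : NCPowerSeries σ R) (w : List σ) :
    (f * g) w = ∑ k ∈ Finset.range (w.length + 1), f (w.take k) * g (w.drop k) := rfl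

theorem one_nil : (1 : NCPowerSeries σ R) [] = 1 := rfl

theorem one_cons (i : σ) (w : List σ) : (1 : NCPowerSeries σ R) (i :: w) = 0 := rfl

theorem mul_nil (f g : NCPowerSeries σ R) : (f * g) [] = f [] * g [] := by
  simp [mul_apply]

theorem mul_cons (f g : NCPowerSeries σ R) (i : σ) (w : List σ) :
    (f * g) (i :: w) = f [] * g (i :: w) + (tail i f * g) w := by
  simp only [mul_apply, List.length_cons]
  rw [Finset.sum_range_succ']
  simp [tail, add_comm]

theorem tail_mul (f g : NCPowerSeries σ R) (i : σ) :
    tail i (f * g) = f [] • tail i g + tail i f * g := by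
  apply ext'
  intro w
  exact mul_cons f g i w

theorem add_mul' (f g h : NCPowerSeries σ R) : (f + g) * h = f * h + g * h := by
  apply ext'
  intro w
  simp [mul_apply, add_apply, add_mul, Finset.sum_add_distrib]

theorem mul_add' (f g h : NCPowerSeries σ R) : f * (g + h) = f * g + f * h := by
  apply ext'
  intro w
  simp [mul_apply, add_apply, mul_add, Finset.sum_add_distrib]

theorem smul_mul' (r : R) (f g : NCPowerSeries σ R) : (r • f) * g = r • (f * g) := by
  apply ext'
  intro w
  simp [mul_apply, smul_apply, mul_assoc, Finset.mul_sum]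

theorem mul_smul' (r : R) (f g : NCPowerSeries σ R) : f * (r • g) = r • (f * g) := by
  apply ext'
  intro w
  simp [mul_apply, smul_apply, mul_left_comm, Finset.mul_sum]

theorem zero_mul' (f : NCPowerSeries σ R) : 0 * f = 0 := by
  apply ext'
  intro w
  simp [mul_apply, zero_apply]

theorem mul_zero' (f : NCPowerSeries σ R) : f * 0 = 0 := by
  apply ext'
  intro w
  simp [mul_apply, zero_apply]

theorem one_mul' (f : NCPowerSeries σ R) : 1 * f = f := by
  apply ext'
  intro w
  cases w with
  | nil => simp [mul_nil, one_nil]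
  | cons i w =>
    have h : tail i (1 : NCPowerSeries σ R) = 0 := rfl
    rw [mul_cons, h, zero_mul', zero_apply, one_nil, one_mul, add_zero]

theorem mul_one' (f : NCPowerSeries σ R) : f * 1 = f := by
  apply ext'
  intro w
  induction w generalizing f with
  | nil => simp [mul_nil, one_nil]
  | cons i w ih => rw [mul_cons, ih, one_cons, mul_zero, zero_add]; rfl

theorem mul_assoc' (f g h : NCPowerSeries σ R) : f * g * h = f * (g * h) := by
  apply ext'
  intro w
  induction w generalizing f with
  | nil => simp [mul_nil, mul_assoc]
  | cons i w ih =>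
    rw [mul_cons, mul_cons, tail_mul, add_mul', add_apply, smul_mul', smul_apply, ih, mul_nil,
      mul_cons]
    ring

end facts

instance {σ R : Type*} [CommRing R] : Ring (NCPowerSeries σ R) :=
  { (inferInstance : AddCommGroup (NCPowerSeries σ R)) with
    mul := (· * ·)
    one := 1
    mul_assoc := mul_assoc'
    one_mul := one_mul'
    mul_one := mul_one'
    left_distrib := mul_add'
    right_distrib := add_mul'
    zero_mul := zero_mul'
    mul_zero := mul_zero' }

instance {σ R : Type*} [CommRing R] : Algebra R (NCPowerSeries σ R) :=
  Algebra.ofModule smul_mul' mul_smul'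

/-- The `R`-derivation sending the variable `i` to `a i`. On a word it replaces each single letter
`i` in turn by `a i`; so the coefficient of `w` is the sum over all ways to write `w = p ++ q ++ r`
of (coefficient of `p ++ i :: r`) times (coefficient of `q` in `a i`). -/
def derivationFun {σ R : Type*} [Fintype σ] [CommRing R] (a : σ → NCPowerSeries σ R)
    (u : NCPowerSeries σ R) : NCPowerSeries σ R :=
  fun w => ∑ k ∈ Finset.range (w.length + 1), ∑ l ∈ Finset.range (w.length - k + 1),
    ∑ i, u (w.take k ++ i :: (w.drop k).drop l) * a i ((w.drop k).take l)

theorem derivationFun_apply {σ R : Type*} [Fintype σ] [CommRing R] (a : σ → NCPowerSeries σ R)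
    (u : NCPowerSeries σ R) (w : List σ) : derivationFun a u w =
      ∑ k ∈ Finset.range (w.length + 1), ∑ l ∈ Finset.range (w.length - k + 1),
        ∑ i, u (w.take k ++ i :: (w.drop k).drop l) * a i ((w.drop k).take l) := rfl

/-- `derivationFun` as a linear map. -/
def derivation {σ R : Type*} [Fintype σ] [CommRing R] (a : σ → NCPowerSeries σ R) :
    NCPowerSeries σ R →ₗ[R] NCPowerSeries σ R where
  toFun := derivationFun a
  map_add' u v := by
    apply ext'
    intro w
    simp only [derivationFun_apply, add_apply, add_mul, Finset.sum_add_distrib]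
  map_smul' r u := by
    apply ext'
    intro w
    simp only [derivationFun_apply, smul_apply, mul_assoc, Finset.mul_sum, RingHom.id_apply]

section facts

theorem sum_apply {σ R ι : Type*} [CommRing R] (s : Finset ι) (f : ι → NCPowerSeries σ R)
    (w : List σ) : (∑ i ∈ s, f i) w = ∑ i ∈ s, f i w :=
  Finset.sum_apply w s f

variable {σ R : Type*} [Fintype σ] [CommRing R]

theorem derivation_apply (a : σ → NCPowerSeries σ R)
    (u : NCPowerSeries σ R) (w : List σ) : derivation a u w =
      ∑ k ∈ Finset.range (w.length + 1), ∑ l ∈ Finset.range (w.length - k + 1),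
        ∑ i, u (w.take k ++ i :: (w.drop k).drop l) * a i ((w.drop k).take l) := rfl

theorem derivation_nil (a : σ → NCPowerSeries σ R) (u : NCPowerSeries σ R) :
    derivation a u [] = (∑ i, a i * tail i u) [] := by
  simp [derivation_apply, sum_apply, mul_nil, tail, mul_comm]

theorem derivation_cons (a : σ → NCPowerSeries σ R) (u : NCPowerSeries σ R) (j : σ) (w : List σ) :
    derivation a u (j :: w) = (∑ i, a i * tail i u) (j :: w) + derivation a (tail j u) w := by
  simp only [derivation_apply, List.length_cons]
  rw [Finset.sum_range_succ', add_comm]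
  congr 1
  · rw [sum_apply, Finset.sum_comm]
    simp [mul_apply, tail, mul_comm]
  · simp [tail]

theorem derivation_leibniz (a : σ → NCPowerSeries σ R) (u v : NCPowerSeries σ R) :
    derivation a (u * v) = derivation a u * v + u * derivation a v := by
  have key : ∀ u v : NCPowerSeries σ R, (∑ i, a i * tail i (u * v))
      = u [] • (∑ i, a i * tail i v) + (∑ i, a i * tail i u) * v := by
    intro u v
    simp only [tail_mul, mul_add, Finset.sum_add_distrib, mul_smul', Finset.smul_sum,
      Finset.sum_mul, mul_assoc]
  apply ext'
  intro w
  induction w generalizing u with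
  | nil =>
    rw [derivation_nil, key, add_apply, add_apply, smul_apply, mul_nil, mul_nil, mul_nil,
      derivation_nil, derivation_nil]
    ring
  | cons j w ih =>
    have h : tail j (derivation a u) = tail j (∑ i, a i * tail i u) + derivation a (tail j u) := by
      apply ext'
      intro w
      exact derivation_cons a u j w
    rw [derivation_cons, key, tail_mul, map_add, map_smul, add_apply, add_apply, add_apply,
      smul_apply, smul_apply, ih, add_apply, mul_cons, mul_cons, mul_cons, h, add_mul, add_apply,
      derivation_cons, derivation_nil]
    ring

theorem derivation_X [DecidableEq σ] (a : σ → NCPowerSeries σ R) (i : σ) :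
    derivation a (X i) = a i := by
  have h1 : ∀ j, tail j (X i : NCPowerSeries σ R) = if j = i then 1 else 0 := by
    intro j
    apply ext'
    intro w
    by_cases hj : j = i
    · subst hj
      cases w <;> simp [tail, X, one_nil, one_cons]
    · simp [tail, X, hj, zero_apply]
  have h2 : (∑ j, a j * tail j (X i : NCPowerSeries σ R)) = a i := by
    simp [h1]
  have h3 : derivation a (1 : NCPowerSeries σ R) = 0 := by
    have := derivation_leibniz a 1 1
    simpa using this
  apply ext'
  intro w
  cases w with
  | nil => rw [derivation_nil, h2]
  | cons j w =>
    rw [derivation_cons, h2, h1]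
    split_ifs <;> simp [h3, zero_apply]

end facts

end NCPowerSeries

/-! ### Power series in commutative or noncommutative variables, treated uniformly -/

/-- The two kinds of variables `z = (z_1, …, z_n)`. -/
inductive VarKind
  | comm
  | noncomm

/-- The monomials in `z_1, …, z_n`. -/
def Mono : VarKind → ℕ → Type
  | .comm, n => Fin n →₀ ℕ
  | .noncomm, n => List (Fin n)

/-- The total degree of a monomial. -/
def Mono.degree : {c : VarKind} → {n : ℕ} → Mono c n → ℕ
  | .comm, n, d => Finsupp.degree (show Fin n →₀ ℕ from d)
  | .noncomm, n, w => List.length (show List (Fin n) from w)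

/-- The algebra `R⟨⟨z⟩⟩` of formal power series in `n` commutative, respectively noncommutative
free, variables. -/
def FPS : VarKind → ℕ → Type u → Type u
  | .comm, n, R => MvPowerSeries (Fin n) R
  | .noncomm, n, R => NCPowerSeries (Fin n) R

namespace FPS

instance {c : VarKind} {n : ℕ} {R : Type u} [CommRing R] : Ring (FPS c n R) :=
  match c with
  | .comm => inferInstanceAs (Ring (MvPowerSeries (Fin n) R))
  | .noncomm => inferInstanceAs (Ring (NCPowerSeries (Fin n) R))

instance {c : VarKind} {n : ℕ} {R : Type u} [CommRing R] : Algebra R (FPS c n R) :=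
  match c with
  | .comm => inferInstanceAs (Algebra R (MvPowerSeries (Fin n) R))
  | .noncomm => inferInstanceAs (Algebra R (NCPowerSeries (Fin n) R))

/-- The variable `z_i`. -/
def X {c : VarKind} {n : ℕ} {R : Type u} [CommRing R] (i : Fin n) : FPS c n R :=
  match c with
  | .comm => (MvPowerSeries.X i : MvPowerSeries (Fin n) R)
  | .noncomm => (NCPowerSeries.X i : NCPowerSeries (Fin n) R)

/-- The coefficient of a monomial. -/
def coeff {c : VarKind} {n : ℕ} {R : Type u} [CommRing R] (w : Mono c n) (f : FPS c n R) : R :=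
  match c, w, f with
  | .comm, w, f => MvPowerSeries.coeff (R := R) (σ := Fin n) w f
  | .noncomm, w, f => (show NCPowerSeries (Fin n) R from f) w

/-- The power series with given coefficients. -/
def ofCoeff {c : VarKind} {n : ℕ} {R : Type u} (f : Mono c n → R) : FPS c n R :=
  match c, f with
  | .comm, f => (show MvPowerSeries (Fin n) R from f)
  | .noncomm, f => (show NCPowerSeries (Fin n) R from f)

/-- The derivation `∑ a_i ∂/∂z_i` of `R[[z_1, …, z_n]]`. -/
def mvDer {n : ℕ} {R : Type u} [CommRing R] (a : Fin n → MvPowerSeries (Fin n) R) :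
    Derivation R (MvPowerSeries (Fin n) R) (MvPowerSeries (Fin n) R) :=
  ∑ i, a i • MvPowerSeries.pderiv R i

/-- The `R`-derivation `[a ∂/∂z]` of `R⟨⟨z⟩⟩`, which sends each `z_i` to `a_i`. -/
def der {c : VarKind} {n : ℕ} {R : Type u} [CommRing R] (a : Fin n → FPS c n R) :
    Module.End R (FPS c n R) :=
  match c, a with
  | .comm, a => (mvDer a).toLinearMap
  | .noncomm, a => NCPowerSeries.derivation (σ := Fin n) (R := R) a

section facts

variable {c : VarKind} {n : ℕ} {R : Type u} [CommRing R]

theorem coeff_ofCoeff (f : Mono c n → R) (w : Mono c n) : coeff w (ofCoeff f) = f w := by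
  cases c <;> rfl

theorem ext {f g : FPS c n R} (h : ∀ w, coeff w f = coeff w g) : f = g := by
  cases c
  · exact MvPowerSeries.ext h
  · exact funext h

theorem coeff_add (w : Mono c n) (f g : FPS c n R) : coeff w (f + g) = coeff w f + coeff w g := by
  cases c <;> rfl

theorem coeff_smul (w : Mono c n) (r : R) (f : FPS c n R) : coeff w (r • f) = r * coeff w f := by
  cases c <;> rfl

theorem mvDer_X (a : Fin n → MvPowerSeries (Fin n) R) (i : Fin n) :
    mvDer a (MvPowerSeries.X i) = a i := by
  rw [mvDer, ← Derivation.coeFnAddMonoidHom_apply, map_sum, Finset.sum_apply,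
    Finset.sum_eq_single i]
  · simp
  · intro j _ hj
    simp [MvPowerSeries.pderiv_X_of_ne (Ne.symm hj)]
  · simp

theorem der_leibniz (a : Fin n → FPS c n R) (u v : FPS c n R) :
    der a (u * v) = der a u * v + u * der a v := by
  cases c
  · refine ((mvDer a).leibniz u v).trans ((add_comm _ _).trans ?_)
    exact congrArg₂ (· + ·) (mul_comm (G := MvPowerSeries (Fin n) R) _ _) rfl
  · exact NCPowerSeries.derivation_leibniz a u v

theorem der_X (a : Fin n → FPS c n R) (i : Fin n) : der a (X i) = a i := by
  cases c
  · exact mvDer_X a i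
  · exact NCPowerSeries.derivation_X a i

end facts

/-! ### The central parameter `t`: comparison of `K[[t]]⟨⟨z⟩⟩` and `K⟨⟨z⟩⟩[[t]]` -/

section parameter

variable {c : VarKind} {n : ℕ} {K : Type u} [CommRing K]

/-- The coefficient of `t ^ m`, an element of `K⟨⟨z⟩⟩`. -/
def tCoeff (m : ℕ) (f : FPS c n K⟦X⟧) : FPS c n K :=
  ofCoeff fun w => PowerSeries.coeff m (coeff w f)

/-- The series `∑ t ^ m b_m`. -/
def tSeries (b : ℕ → FPS c n K) : FPS c n K⟦X⟧ :=
  ofCoeff fun w => PowerSeries.mk fun m => coeff w (b m)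

/-- The inclusion of `K⟨⟨z⟩⟩` in `K[[t]]⟨⟨z⟩⟩` (series that do not depend on `t`). -/
def tConst (u : FPS c n K) : FPS c n K⟦X⟧ :=
  ofCoeff fun w => PowerSeries.C (coeff w u)

/-- The derivative `∂/∂t`. -/
def tDeriv (f : FPS c n K⟦X⟧) : FPS c n K⟦X⟧ :=
  ofCoeff fun w => PowerSeries.derivative K (coeff w f)

/-- A `K[[t]]`-linear operator `P` on `K[[t]]⟨⟨z⟩⟩` is a power series `P = ∑ t ^ m P_m` whose
coefficients are `K`-linear operators on `K⟨⟨z⟩⟩`; this is `P_m`. -/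
def opCoeff (P : Module.End K⟦X⟧ (FPS c n K⟦X⟧)) (m : ℕ) : Module.End K (FPS c n K) where
  toFun u := tCoeff m (P (tConst u))
  map_add' u v := by
    have h : (tConst (u + v) : FPS c n K⟦X⟧) = tConst u + tConst v :=
      ext fun w => by simp [tConst, coeff_ofCoeff, coeff_add]
    rw [h, map_add]
    exact ext fun w => by simp [tCoeff, coeff_ofCoeff, coeff_add]
  map_smul' r u := by
    have h : (tConst (r • u) : FPS c n K⟦X⟧) = (PowerSeries.C r : K⟦X⟧) • tConst u :=
      ext fun w => by simp [tConst, coeff_ofCoeff, coeff_smul]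
    rw [h, map_smul]
    exact ext fun w => by simp [tCoeff, coeff_ofCoeff, coeff_smul]

/-- `e ^ D u = ∑ D ^ k u / k!`, for a `K[[t]]`-linear operator `D` on `K[[t]]⟨⟨z⟩⟩` that is
divisible by `t`: then `D ^ k u` has no term in `t ^ m` for `k > m`, so that the coefficient of
`t ^ m` is the finite sum below. -/
def expApply [Algebra ℚ K] (D : Module.End K⟦X⟧ (FPS c n K⟦X⟧)) (u : FPS c n K⟦X⟧) :
    FPS c n K⟦X⟧ :=
  tSeries fun m => ∑ k ∈ Finset.range (m + 1),
    algebraMap ℚ K (1 / (k.factorial : ℚ)) • tCoeff m ((D ^ k) u)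

end parameter

end FPS

/-! ### The automorphisms `F_t` and their differential operators -/

section automorphisms

variable {c : VarKind} {n : ℕ} {K : Type u} [CommRing K]

/-- An automorphism `F_t` of `K[[t]]⟨⟨z⟩⟩` over `K[[t]]` is seen as the map `u ↦ u(F_t)`, so that
its components are the `F (z_i)`, and its inverse `G_t` is `F.symm`. -/
abbrev FAut (c : VarKind) (n : ℕ) (K : Type u) [CommRing K] : Type u :=
  FPS c n K⟦X⟧ ≃ₐ[K⟦X⟧] FPS c n K⟦X⟧

namespace FAut

/-- `H_t`, where `F_t(z) = z - H_t(z)`. -/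
def H (F : FAut c n K) (i : Fin n) : FPS c n K⟦X⟧ := FPS.X i - F (FPS.X i)

/-- `M_t`, where `G_t(z) = z + M_t(z)` for the inverse `G_t` of `F_t`. -/
def M (F : FAut c n K) (i : Fin n) : FPS c n K⟦X⟧ := F.symm (FPS.X i) - FPS.X i

/-- The class `𝔸_t^[α]⟨⟨z⟩⟩`: automorphisms `z - H_t(z)` such that `H_t` has order at least `α`
in `z` and `H_t` vanishes at `t = 0`. -/
def IsOfClass (α : ℕ) (F : FAut c n K) : Prop :=
  (∀ i, ∀ w : Mono c n, w.degree < α → FPS.coeff w (F.H i) = 0) ∧ ∀ i, FPS.tCoeff 0 (F.H i) = 0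

/-- The operators `λ_m`, where `f(t) = ∑ t ^ m λ_m` and `f(-t) u = u(F_t)`. -/
def lam (F : FAut c n K) (m : ℕ) : Module.End K (FPS c n K) :=
  (-1 : K) ^ m • FPS.opCoeff F.toLinearMap m

/-- The operators `s_m`, where `g(t) = ∑ t ^ m s_m` and `g(t) u = u(G_t)`. -/
def s (F : FAut c n K) (m : ℕ) : Module.End K (FPS c n K) :=
  FPS.opCoeff F.symm.toLinearMap m

/-- The derivation `h(t) = [∂M_t/∂t(F_t) ∂/∂z]`. -/
def h (F : FAut c n K) : Module.End K⟦X⟧ (FPS c n K⟦X⟧) :=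
  FPS.der fun i => F (FPS.tDeriv (F.M i))

/-- The derivation `m(t) = [∂H_t/∂t(G_t) ∂/∂z]`. -/
def m (F : FAut c n K) : Module.End K⟦X⟧ (FPS c n K⟦X⟧) :=
  FPS.der fun i => F.symm (FPS.tDeriv (F.H i))

/-- The operators `ψ_k` (`k ≥ 1`), where `h(t) = ∑ t ^ (k - 1) ψ_k`. -/
def psi (F : FAut c n K) (k : ℕ) : Module.End K (FPS c n K) := FPS.opCoeff F.h (k - 1)

/-- The operators `ξ_k` (`k ≥ 1`), where `m(t) = ∑ t ^ (k - 1) ξ_k`. -/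
def xi (F : FAut c n K) (k : ℕ) : Module.End K (FPS c n K) := FPS.opCoeff F.m (k - 1)

/-- `a` is the D-Log of `F_t`: the components of `a` lie in `t K[[t]]⟨⟨z⟩⟩`, and the derivation
`d(t) = -[a ∂/∂z]` satisfies `e ^ d(t) u = u(G_t)` for all `u`. -/
def IsDLog [Algebra ℚ K] (F : FAut c n K) (a : Fin n → FPS c n K⟦X⟧) : Prop :=
  (∀ i, FPS.tCoeff 0 (a i) = 0) ∧ ∀ u, FPS.expApply (-FPS.der a) u = F.symm u

end FAut

end automorphisms

/-! ### Compositions (as lists of positive integers) -/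

namespace Compo

/-- `π_u(I) = ∏_j (i_1 + ⋯ + i_j)`. -/
def piU (I : List ℕ) : ℕ := ∏ j ∈ Finset.range I.length, (I.take (j + 1)).sum

/-- `I ≽ J`, that is `I` is a refinement of `J`: cut into suitable consecutive pieces, `I` has
the parts of `J` as the sums of the pieces. -/
def Refines (I J : List ℕ) : Prop := ∃ L : List (List ℕ), L.flatten = I ∧ L.map List.sum = J

/-- Split a list after the shortest initial piece whose sum is at least the given weight. -/
def splitWeight : ℕ → List ℕ → List ℕ × List ℕ
  | 0, I => ([], I)
  | _ + 1, [] => ([], [])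
  | k + 1, i :: I => (i :: (splitWeight (k + 1 - i) I).1, (splitWeight (k + 1 - i) I).2)

/-- The pieces `I_1, I_2, …` of a refinement `I` of `J`; their sums are the parts of `J`. -/
def pieces : List ℕ → List ℕ → List (List ℕ)
  | _, [] => []
  | I, j :: J => (splitWeight j I).1 :: pieces (splitWeight j I).2 J

theorem splitWeight_append (P I : List ℕ) (hP : ∀ x ∈ P, 0 < x) :
    splitWeight P.sum (P ++ I) = (P, I) := by
  induction P with
  | nil => simp [splitWeight]
  | cons x P ih =>
    have hx : 0 < x := hP x (by simp)
    have ih' := ih fun y hy => hP y (by simp [hy])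
    obtain ⟨k, hk⟩ : ∃ k, (x :: P).sum = k + 1 := ⟨(x :: P).sum - 1, by simp; omega⟩
    have hk' : k + 1 - x = P.sum := by simp at hk; omega
    rw [hk, List.cons_append, splitWeight, hk', ih']

/-- For lists of positive integers, the pieces witnessing a refinement are unique, and they are
the ones computed by `pieces`. -/
theorem pieces_eq (L : List (List ℕ)) (hL : ∀ x ∈ L.flatten, 0 < x) :
    pieces L.flatten (L.map List.sum) = L := by
  induction L with
  | nil => rfl
  | cons P L ih =>
    have h1 : ∀ x ∈ P, 0 < x := fun x hx => hL x (by simp [hx])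
    have h2 : ∀ x ∈ L.flatten, 0 < x := fun x hx => hL x (by
      rw [List.flatten_cons, List.mem_append]; exact Or.inr hx)
    rw [List.flatten_cons, List.map_cons, pieces, splitWeight_append P _ h1, ih h2]

/-- `π_u(I, J) = ∏_a π_u(I_a)`, for a refinement `I` of `J` with pieces `I_1, I_2, …`. -/
def piU₂ (I J : List ℕ) : ℕ := ((pieces I J).map piU).prod

open Classical in
/-- `∑_{J : I ≽ J} c(J)`, the sum over the compositions `J` that are refined by `I`. -/
def coarserSum {k : ℕ} (I : Composition k) (q : Composition k → ℚ) : ℚ :=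
  ∑ J ∈ Finset.univ.filter (fun J : Composition k => Refines I.blocks J.blocks), q J

/-- `∑_I q(I) t ^ |I| w ^ I z_i`, the sum over all (non-empty) compositions `I`, where
`w ^ I = w_{i_1} w_{i_2} ⋯` is a product of operators; the terms are collected by the
weight `k = |I|`. -/
def series {c : VarKind} {n : ℕ} {K : Type u} [CommRing K] [Algebra ℚ K]
    (q : (k : ℕ) → Composition k → ℚ) (w : ℕ → Module.End K (FPS c n K)) (i : Fin n) :
    FPS c n K⟦X⟧ :=
  FPS.tSeries fun k => if k = 0 then 0 else
    ∑ I : Composition k, algebraMap ℚ K (q k I) • (I.blocks.map w).prod (FPS.X i)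

end Compo

end

/-!
The `K[[t]]`-linear operators on `K[[t]]⟨⟨z⟩⟩` form the ring `E[[t]]`, where `E` is the ring of
`K`-linear operators on `K⟨⟨z⟩⟩`: such an operator is automatically `t`-adically continuous, hence
it is determined by its coefficients (`FPS.opSeries`). A power series over `K` can be evaluated at
every element of `E[[t]]` without constant term (`PowerSeries.evalAt`), and the identities between
the series `exp` and `log` are inherited by their values. The operator `u ↦ u(G_t)` is the identity
at `t = 0`, because an endomorphism of `K⟨⟨z⟩⟩` that fixes the variables is trivial. So it has a
unique logarithm `D` in `t E[[t]]`, and this is the only candidate for `d(t)`.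

It has to be shown that `D` is a derivation. If `t ^ m` divides the failure `δ` of the Leibniz rule
for `D`, then `t ^ (m + 1)` divides the failures of the Leibniz rules for `D ^ 2`, `D ^ 3`, …,
because `D` is divisible by `t`. As `exp D` is multiplicative, the coefficient of `t ^ m` in `δ`
then vanishes, and `δ = 0` follows by induction on `m` (`FPS.leibniz_of_expApply_mul`). Derivations
of `K[[t]]⟨⟨z⟩⟩` are determined by their values on the variables (`FPS.eq_of_leibniz`), so that `D`
is `-[a ∂/∂z]` for a unique `a`.

The formulas now come from the logarithm series. Its coefficient of `t ^ m` at `1 + ∑ t ^ i w_i` is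
a sum of products `w ^ I` over the compositions `I` of `m`; this gives the formula with `s`, and
that with `λ`, since `-D` is the logarithm of `u ↦ u(F_t)`. Conjugating `∂/∂t` by an automorphism
changes it by a `K[[t]]`-linear derivation (`FAut.tDeriv_apply`), and therefore `g(t) : u ↦ u(G_t)`
solves both `g' = g h` and `g' = m g`, where `h = ∑ t ^ (k - 1) ψ_k` and `m = ∑ t ^ (k - 1) ξ_k`.
Recursively this expands `s_m` as a sum of `ψ ^ I / π_u(I)`, or of `ξ ^ I / π_u(Ī)`, over the
compositions `I` of `m`. Hence `s ^ J` is a sum over the refinements `I` of `J`, with coefficients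
`1 / π_u(I, J)` or `1 / π_u(Ī, J̄)` (`Compo.prod_map_eq_sum_refines`), and the formula with `s`
turns into those with `ψ` and `ξ`.
-/

/-! ### Logarithm and exponential as power series -/

namespace PowerSeries

section expLog

variable (K : Type*) [CommRing K] [Algebra ℚ K]

theorem deriv_log_mul_one_add_X : d⁄dX K (log K) * (1 + X) = 1 := by
  ext n
  rw [deriv_log, mul_add, mul_one, map_add]
  cases n with
  | zero => simp
  | succ n => simp [coeff_succ_mul_X, pow_succ, coeff_one]

theorem log_subst_exp_sub_one : (log K).subst (exp K - 1) = X := by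
  have htf : IsAddTorsionFree K := IsAddTorsionFree.of_module_rat K
  have hs : HasSubst (exp K - 1) := HasSubst.exp_sub_one
  refine derivative.ext ?_ ?_
  · have h := congrArg (subst (exp K - 1)) (deriv_log_mul_one_add_X K)
    rw [subst_mul hs, subst_add hs, subst_X hs, ← coe_substAlgHom hs, map_one,
      add_sub_cancel, coe_substAlgHom] at h
    rw [derivative_subst hs, derivative_X, map_sub, derivative_exp, derivative_one, sub_zero]
    exact h
  · rw [constantCoeff_X]
    refine constantCoeff_subst_eq_zero ?_ _ constantCoeff_log
    rw [map_sub, map_one, ← constantCoeff_eq, constantCoeff_exp, sub_self]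

theorem exp_subst_log : (exp K).subst (log K) = 1 + X := by
  have htf : IsAddTorsionFree K := IsAddTorsionFree.of_module_rat K
  have hs : HasSubst (log K) := HasSubst.log
  -- `exp (log (1 + X)) / (1 + X)` has derivative zero, and `d/dX log (1 + X)` is `1 / (1 + X)`.
  have key : (exp K).subst (log K) * d⁄dX K (log K) = 1 := by
    refine derivative.ext ?_ ?_
    · have h1 : d⁄dX K ((exp K).subst (log K)) = (exp K).subst (log K) * d⁄dX K (log K) := by
        rw [derivative_subst hs, derivative_exp]
      have h2 : d⁄dX K (d⁄dX K (log K)) = - d⁄dX K (log K) * d⁄dX K (log K) := by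
        have h3 := congrArg (d⁄dX K) (deriv_log_mul_one_add_X K)
        simp only [Derivation.leibniz, map_add, derivative_X, derivative_one, smul_eq_mul,
          zero_add, mul_one] at h3
        linear_combination d⁄dX K (log K) * h3 -
          d⁄dX K (d⁄dX K (log K)) * deriv_log_mul_one_add_X K
      rw [Derivation.leibniz, h1, h2, derivative_one, smul_eq_mul, smul_eq_mul]
      ring
    · rw [map_mul]
      have h4 : constantCoeff ((exp K).subst (log K)) = 1 := by
        have h5 : (exp K).subst (log K) = (exp K - 1).subst (log K) + 1 := by
          rw [subst_sub hs, ← coe_substAlgHom hs, map_one, sub_add_cancel]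
        rw [h5, map_add, map_one]
        rw [show constantCoeff ((exp K - 1).subst (log K)) = 0 from
          constantCoeff_subst_eq_zero constantCoeff_log _ (by simp),
          zero_add]
      rw [h4, deriv_log]
      simp
  calc (exp K).subst (log K)
      = (exp K).subst (log K) * (d⁄dX K (log K) * (1 + X)) := by
        rw [deriv_log_mul_one_add_X, mul_one]
    _ = 1 + X := by rw [← mul_assoc, key, one_mul]

end expLog

/-! ### Evaluation of power series at elements divisible by the parameter -/

section evalAt

variable {K E : Type*} [CommRing K] [Ring E] [Algebra K E]

theorem coeff_pow_eq_zero_of_lt {N : E⟦X⟧} (hN : constantCoeff N = 0) {m k : ℕ} (h : m < k) :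
    coeff m (N ^ k) = 0 := by
  obtain ⟨P, rfl⟩ := X_dvd_iff.mpr hN
  rw [((commute_X P).symm).mul_pow, coeff_X_pow_mul', if_neg (by omega)]

/-- The value `p(N) = ∑ p_k N ^ k` of a power series at an element `N` of a ring of power series
over a noncommutative algebra. Only the summands with `k ≤ m` are kept in the coefficient of
degree `m`; the others vanish if `N` has no constant term. -/
noncomputable def evalAt (N : E⟦X⟧) (p : K⟦X⟧) : E⟦X⟧ :=
  mk fun m => ∑ k ∈ Finset.range (m + 1), coeff k p • coeff m (N ^ k)

theorem coeff_evalAt (N : E⟦X⟧) (p : K⟦X⟧) (m : ℕ) :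
    coeff m (evalAt N p) = ∑ k ∈ Finset.range (m + 1), coeff k p • coeff m (N ^ k) :=
  coeff_mk _ _

theorem coeff_evalAt_of_lt {N : E⟦X⟧} (hN : constantCoeff N = 0) (p : K⟦X⟧) {m n : ℕ}
    (h : m < n) : coeff m (evalAt N p) = ∑ k ∈ Finset.range n, coeff k p • coeff m (N ^ k) := by
  rw [coeff_evalAt]
  refine Finset.sum_subset (Finset.range_mono h) fun k _ hk => ?_
  rw [coeff_pow_eq_zero_of_lt hN (by simpa using hk), smul_zero]

theorem constantCoeff_evalAt (N : E⟦X⟧) {p : K⟦X⟧} (hp : constantCoeff p = 0) :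
    constantCoeff (evalAt N p) = 0 := by
  rw [← coeff_zero_eq_constantCoeff_apply, coeff_evalAt]
  simp [hp]

theorem evalAt_sub (N : E⟦X⟧) (p q : K⟦X⟧) : evalAt N (p - q) = evalAt N p - evalAt N q := by
  ext m
  simp [coeff_evalAt, sub_smul, Finset.sum_sub_distrib]

theorem evalAt_add (N : E⟦X⟧) (p q : K⟦X⟧) : evalAt N (p + q) = evalAt N p + evalAt N q := by
  ext m
  simp [coeff_evalAt, add_smul, Finset.sum_add_distrib]

theorem evalAt_one (N : E⟦X⟧) : evalAt N (1 : K⟦X⟧) = 1 := by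
  ext m
  rw [coeff_evalAt, Finset.sum_range_succ']
  simp [coeff_one]

theorem evalAt_X {N : E⟦X⟧} (hN : constantCoeff N = 0) : evalAt N (X : K⟦X⟧) = N := by
  ext m
  rw [coeff_evalAt_of_lt hN _ (show m < m + 2 by omega), Finset.sum_eq_single 1]
  · simp
  · intro k _ hk
    simp [coeff_X, hk]
  · simp

/-- Summation over a triangle or over a square, for a family supported in the triangle. -/
theorem sum_range_sum_antidiagonal {V : Type*} [AddCommMonoid V] (f : ℕ → ℕ → V) {m : ℕ}
    (h : ∀ i j, m < i + j → f i j = 0) : ∑ k ∈ Finset.range (m + 1),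
      ∑ x ∈ Finset.HasAntidiagonal.antidiagonal k, f x.1 x.2 =
        ∑ i ∈ Finset.range (m + 1), ∑ j ∈ Finset.range (m + 1), f i j := by
  rw [← Finset.sum_product', Finset.sum_sigma']
  refine Finset.sum_of_injOn (fun x => x.2) ?_ ?_ ?_ fun _ _ => rfl
  · rintro ⟨k, i, j⟩ h ⟨k', i', j'⟩ h' h''
    simp only [Finset.coe_sigma, Set.mem_sigma_iff, Finset.mem_coe,
      Finset.HasAntidiagonal.mem_antidiagonal] at h h'
    simp only [Prod.mk.injEq] at h''
    obtain ⟨rfl, rfl⟩ := h''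
    obtain rfl := h.2.symm.trans h'.2
    rfl
  · rintro ⟨k, i, j⟩ h
    simp at h ⊢
    omega
  · rintro ⟨i, j⟩ _ h'
    refine h i j ?_
    by_contra hm
    exact h' ⟨⟨i + j, i, j⟩, by simpa using by omega, rfl⟩

theorem evalAt_mul {N : E⟦X⟧} (hN : constantCoeff N = 0) (p q : K⟦X⟧) :
    evalAt N (p * q) = evalAt N p * evalAt N q := by
  ext m
  -- both sides are the sum of `p_i q_j (N ^ (i + j))_m` over all `i` and `j`
  have hl : coeff m (evalAt N (p * q)) = ∑ i ∈ Finset.range (m + 1), ∑ j ∈ Finset.range (m + 1),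
      (coeff i p * coeff j q) • coeff m (N ^ (i + j)) := by
    rw [coeff_evalAt, ← sum_range_sum_antidiagonal fun i j =>
      (coeff i p * coeff j q) • coeff m (N ^ (i + j))]
    · refine Finset.sum_congr rfl fun k _ => ?_
      rw [coeff_mul, Finset.sum_smul]
      refine Finset.sum_congr rfl fun x hx => ?_
      rw [Finset.HasAntidiagonal.mem_antidiagonal.mp hx]
    · intro i j h
      rw [coeff_pow_eq_zero_of_lt hN h, smul_zero]
  have hr : coeff m (evalAt N p * evalAt N q) = ∑ i ∈ Finset.range (m + 1),
      ∑ j ∈ Finset.range (m + 1), (coeff i p * coeff j q) • coeff m (N ^ (i + j)) := by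
    rw [coeff_mul]
    have h1 : ∀ x ∈ Finset.HasAntidiagonal.antidiagonal m,
        coeff x.1 (evalAt N p) * coeff x.2 (evalAt N q) =
          ∑ i ∈ Finset.range (m + 1), ∑ j ∈ Finset.range (m + 1),
            (coeff i p * coeff j q) • (coeff x.1 (N ^ i) * coeff x.2 (N ^ j)) := by
      intro x hx
      have hx' := Finset.HasAntidiagonal.mem_antidiagonal.mp hx
      rw [coeff_evalAt_of_lt hN p (show x.1 < m + 1 by omega),
        coeff_evalAt_of_lt hN q (show x.2 < m + 1 by omega), Finset.sum_mul_sum]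
      simp only [smul_mul_smul_comm]
    rw [Finset.sum_congr rfl h1, Finset.sum_comm]
    refine Finset.sum_congr rfl fun i _ => ?_
    rw [Finset.sum_comm]
    refine Finset.sum_congr rfl fun j _ => ?_
    rw [← Finset.smul_sum, pow_add, coeff_mul]
  rw [hl, hr]

theorem evalAt_pow {N : E⟦X⟧} (hN : constantCoeff N = 0) (p : K⟦X⟧) (k : ℕ) :
    evalAt N (p ^ k) = evalAt N p ^ k := by
  induction k with
  | zero => simp [evalAt_one]
  | succ k ih => rw [pow_succ, pow_succ, evalAt_mul hN, ih]

theorem evalAt_subst {N : E⟦X⟧} (hN : constantCoeff N = 0) (p q : K⟦X⟧)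
    (hp : constantCoeff p = 0) : evalAt N (q.subst p) = evalAt (evalAt N p) q := by
  ext m
  have h1 : ∀ e ∈ Finset.range (m + 1), coeff e (q.subst p) =
      ∑ k ∈ Finset.range (m + 1), coeff k q * coeff e (p ^ k) := by
    intro e he
    rw [coeff_subst' (HasSubst.of_constantCoeff_zero' hp)]
    refine finsum_eq_sum_of_support_subset _ fun k hk => ?_
    by_contra hk'
    refine hk ?_
    have h2 : e < k := by simp at he hk'; omega
    simp [coeff_pow_eq_zero_of_lt hp h2]
  rw [coeff_evalAt, coeff_evalAt, Finset.sum_congr rfl fun e he => by rw [h1 e he]]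
  simp only [Finset.sum_smul, ← evalAt_pow hN, coeff_evalAt, Finset.smul_sum, smul_smul]
  exact Finset.sum_comm

variable [Algebra ℚ K]

theorem constantCoeff_evalAt_log (N : E⟦X⟧) : constantCoeff (evalAt N (log K)) = 0 :=
  constantCoeff_evalAt N constantCoeff_log

theorem evalAt_exp_log {N : E⟦X⟧} (hN : constantCoeff N = 0) :
    evalAt (evalAt N (log K)) (exp K) = 1 + N := by
  rw [← evalAt_subst hN _ _ constantCoeff_log, exp_subst_log, evalAt_add, evalAt_one,
    evalAt_X hN]

theorem evalAt_log_exp_sub_one {N : E⟦X⟧} (hN : constantCoeff N = 0) :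
    evalAt (evalAt N (exp K) - 1) (log K) = N := by
  have h : evalAt N (exp K) - 1 = evalAt N (exp K - 1) := by rw [evalAt_sub, evalAt_one]
  rw [h, ← evalAt_subst hN _ _ (by simp), log_subst_exp_sub_one, evalAt_X hN]

theorem evalAt_neg_exp_mul {N : E⟦X⟧} (hN : constantCoeff N = 0) :
    evalAt (-N) (exp K) * evalAt N (exp K) = 1 := by
  have h : evalAt (-N) (exp K) = evalAt N (evalNegHom (exp K)) := by
    ext m
    simp only [coeff_evalAt, neg_pow N, evalNegHom, coeff_rescale]
    refine Finset.sum_congr rfl fun k _ => ?_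
    have : ((-1 : E⟦X⟧) ^ k * N ^ k) = (-1 : K) ^ k • N ^ k := by
      rcases Nat.even_or_odd k with hk | hk <;> simp [hk.neg_one_pow]
    rw [this, coeff_smul, smul_smul, mul_comm]
  rw [h, ← evalAt_mul hN, mul_comm, exp_mul_exp_neg_eq_one, evalAt_one]

end evalAt

end PowerSeries

/-! ### Sums over compositions -/

namespace Compo

open Finset.HasAntidiagonal (antidiagonal mem_antidiagonal)

/-- The compositions of `m`, as a finite set of lists of positive integers. -/
def lists (m : ℕ) : Finset (List ℕ) := (Finset.univ : Finset (Composition m)).image (·.blocks)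

theorem mem_lists {m : ℕ} {I : List ℕ} : I ∈ lists m ↔ (∀ x ∈ I, 0 < x) ∧ I.sum = m := by
  simp only [lists, Finset.mem_image, Finset.mem_univ, true_and]
  constructor
  · rintro ⟨J, rfl⟩
    exact ⟨fun x hx => J.blocks_pos hx, J.blocks_sum⟩
  · rintro ⟨h, h'⟩
    exact ⟨⟨I, fun hx => h _ hx, h'⟩, rfl⟩

section sums

variable {V : Type*} [AddCommMonoid V]

theorem sum_composition (m : ℕ) (f : List ℕ → V) :
    ∑ I : Composition m, f I.blocks = ∑ I ∈ lists m, f I := by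
  rw [lists, Finset.sum_image]
  exact fun I _ J _ h => Composition.ext h

theorem lists_zero : lists 0 = {[]} := by
  ext I
  rw [mem_lists, Finset.mem_singleton]
  constructor
  · rintro ⟨h, h'⟩
    cases I with
    | nil => rfl
    | cons x I =>
      have := h x (by simp)
      simp at h'
      omega
  · rintro rfl
    simp

/-- Compositions of a positive integer are sorted by their first part. -/
theorem sum_lists_succ_cons (m : ℕ) (f : List ℕ → V) : ∑ I ∈ lists (m + 1), f I =
    ∑ x ∈ antidiagonal m, ∑ I ∈ lists x.2, f ((x.1 + 1) :: I) := by
  symm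
  rw [Finset.sum_sigma']
  refine Finset.sum_bij (fun y _ => (y.1.1 + 1) :: y.2) ?_ ?_ ?_ ?_
  · rintro ⟨⟨i, j⟩, I⟩ h
    simp only [Finset.mem_sigma, mem_antidiagonal, mem_lists] at h ⊢
    obtain ⟨h1, h2, h3⟩ := h
    refine ⟨?_, by simp; omega⟩
    intro x hx
    rcases List.mem_cons.mp hx with rfl | hx
    · omega
    · exact h2 x hx
  · rintro ⟨⟨i, j⟩, I⟩ h ⟨⟨i', j'⟩, I'⟩ h' heq
    simp only [Finset.mem_sigma, mem_antidiagonal, mem_lists] at h h'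
    simp only [List.cons.injEq, Nat.add_right_cancel_iff] at heq
    obtain ⟨rfl, rfl⟩ := heq
    obtain rfl : j = j' := h.2.2.symm.trans h'.2.2
    rfl
  · intro I h
    obtain ⟨h1, h2⟩ := mem_lists.mp h
    cases I with
    | nil => simp at h2
    | cons x I =>
      have hx : 0 < x := h1 x (by simp)
      refine ⟨⟨(x - 1, I.sum), I⟩, ?_, ?_⟩
      · simp only [Finset.mem_sigma, mem_antidiagonal, mem_lists]
        simp at h2
        exact ⟨by omega, fun y hy => h1 y (by simp [hy]), trivial⟩
      · simp only [List.cons.injEq, and_true]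
        omega
  · intros
    rfl

theorem reverse_mem_lists {m : ℕ} {I : List ℕ} : I.reverse ∈ lists m ↔ I ∈ lists m := by
  simp [mem_lists]

theorem sum_lists_reverse (m : ℕ) (f : List ℕ → V) :
    ∑ I ∈ lists m, f I.reverse = ∑ I ∈ lists m, f I :=
  Finset.sum_bij' (fun I _ => I.reverse) (fun I _ => I.reverse)
    (fun _ h => reverse_mem_lists.mpr h) (fun _ h => reverse_mem_lists.mpr h)
    (fun I _ => I.reverse_reverse) (fun I _ => I.reverse_reverse) fun _ _ => rfl

/-- Compositions of a positive integer are sorted by their last part. -/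
theorem sum_lists_succ_append (m : ℕ) (f : List ℕ → V) : ∑ I ∈ lists (m + 1), f I =
    ∑ x ∈ antidiagonal m, ∑ I ∈ lists x.2, f (I ++ [x.1 + 1]) := by
  rw [← sum_lists_reverse, sum_lists_succ_cons]
  refine Finset.sum_congr rfl fun x _ => ?_
  rw [← sum_lists_reverse]
  simp

end sums

/-! ### Powers, logarithms and the expansion of solutions of linear differential equations -/

section expansions

open PowerSeries

variable {K E : Type*} [CommRing K] [Ring E] [Algebra K E]

theorem coeff_pow_eq_sum_lists {N : E⟦X⟧} (hN : constantCoeff N = 0) (k m : ℕ) :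
    coeff m (N ^ k) = ∑ I ∈ lists m,
      if I.length = k then (I.map fun i => coeff i N).prod else 0 := by
  induction k generalizing m with
  | zero =>
    cases m with
    | zero => simp [lists_zero]
    | succ m => simp [mem_lists, coeff_one]
  | succ k ih =>
    rw [pow_succ', coeff_mul]
    cases m with
    | zero => simp [lists_zero, hN]
    | succ m =>
      rw [Finset.Nat.sum_antidiagonal_succ, sum_lists_succ_cons, coeff_zero_eq_constantCoeff_apply,
        hN, zero_mul, zero_add]
      refine Finset.sum_congr rfl fun x _ => ?_
      rw [ih, Finset.mul_sum]
      refine Finset.sum_congr rfl fun I _ => ?_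
      simp

/-- The coefficients of `p(N)` are sums over compositions. -/
theorem coeff_evalAt_eq_sum_lists {N : E⟦X⟧} (hN : constantCoeff N = 0) (p : K⟦X⟧) (m : ℕ) :
    coeff m (evalAt N p) = ∑ I ∈ lists m,
      coeff I.length p • (I.map fun i => coeff i N).prod := by
  rw [coeff_evalAt]
  simp only [coeff_pow_eq_sum_lists hN, Finset.smul_sum]
  rw [Finset.sum_comm]
  refine Finset.sum_congr rfl fun I hI => ?_
  have hlen : I.length ≤ m := by
    obtain ⟨h1, h2⟩ := mem_lists.mp hI
    rw [← h2]
    exact List.length_le_sum_of_one_le I h1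
  rw [Finset.sum_eq_single I.length]
  · simp
  · intro k _ hk
    rw [if_neg hk.symm, smul_zero]
  · intro h
    exact absurd (Finset.mem_range.mpr (by omega)) h

theorem piU_append_singleton (I : List ℕ) (k : ℕ) : piU (I ++ [k]) = piU I * (I.sum + k) := by
  rw [piU, List.length_append, List.length_singleton, Finset.prod_range_succ, piU]
  congr 1
  · refine Finset.prod_congr rfl fun j hj => ?_
    rw [List.take_append_of_le_length (by have := Finset.mem_range.mp hj; omega)]
  · simp [List.take_of_length_le]

variable [Algebra ℚ K]

theorem eq_of_natCast_smul_eq {x y : E} (m : ℕ) (h : ((m + 1 : ℕ) : K) • x = y) :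
    x = algebraMap ℚ K (1 / (m + 1 : ℕ)) • y := by
  rw [← h, smul_smul, ← map_natCast (algebraMap ℚ K), ← map_mul,
    one_div_mul_cancel (Nat.cast_ne_zero.mpr m.succ_ne_zero), map_one, one_smul]

/-- The solution of `s' = s ψ`, `s(0) = 1`, for `s = ∑ t ^ m s_m` and `ψ = ∑ t ^ (m - 1) ψ_m`. -/
theorem eq_sum_lists_of_deriv_eq_mul_right {s ψ : ℕ → E} (h0 : s 0 = 1)
    (h : ∀ m : ℕ, ((m + 1 : ℕ) : K) • s (m + 1) = ∑ x ∈ antidiagonal m, s x.2 * ψ (x.1 + 1))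
    (m : ℕ) : s m = ∑ I ∈ lists m, algebraMap ℚ K (1 / (piU I : ℚ)) • (I.map ψ).prod := by
  induction m using Nat.strong_induction_on with
  | _ m ih =>
  cases m with
  | zero => simp [lists_zero, h0, piU]
  | succ m =>
    rw [eq_of_natCast_smul_eq m (h m), sum_lists_succ_append, Finset.smul_sum]
    refine Finset.sum_congr rfl fun x hx => ?_
    have hx' := mem_antidiagonal.mp hx
    rw [ih x.2 (by omega), Finset.sum_mul, Finset.smul_sum]
    refine Finset.sum_congr rfl fun I hI => ?_
    have hI' : I.sum + (x.1 + 1) = m + 1 := by rw [(mem_lists.mp hI).2]; omega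
    rw [piU_append_singleton, hI', smul_mul_assoc, smul_smul, ← map_mul, List.map_append,
      List.prod_append, List.map_singleton, List.prod_singleton, Nat.cast_mul,
      one_div_mul_one_div_rev]

/-- The solution of `s' = ξ s`, `s(0) = 1`, for `s = ∑ t ^ m s_m` and `ξ = ∑ t ^ (m - 1) ξ_m`. -/
theorem eq_sum_lists_of_deriv_eq_mul_left {s ξ : ℕ → E} (h0 : s 0 = 1)
    (h : ∀ m : ℕ, ((m + 1 : ℕ) : K) • s (m + 1) = ∑ x ∈ antidiagonal m, ξ (x.1 + 1) * s x.2)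
    (m : ℕ) :
    s m = ∑ I ∈ lists m, algebraMap ℚ K (1 / (piU I.reverse : ℚ)) • (I.map ξ).prod := by
  induction m using Nat.strong_induction_on with
  | _ m ih =>
  cases m with
  | zero => simp [lists_zero, h0, piU]
  | succ m =>
    rw [eq_of_natCast_smul_eq m (h m), sum_lists_succ_cons, Finset.smul_sum]
    refine Finset.sum_congr rfl fun x hx => ?_
    have hx' := mem_antidiagonal.mp hx
    rw [ih x.2 (by omega), Finset.mul_sum, Finset.smul_sum]
    refine Finset.sum_congr rfl fun I hI => ?_
    have hI' : I.reverse.sum + (x.1 + 1) = m + 1 := by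
      rw [List.sum_reverse, (mem_lists.mp hI).2]; omega
    rw [List.reverse_cons, piU_append_singleton, hI', mul_smul_comm, smul_smul, ← map_mul,
      List.map_cons, List.prod_cons, Nat.cast_mul, one_div_mul_one_div_rev]

end expansions

/-! ### Refinements of compositions -/

section refinements

variable {K E : Type*} [CommRing K] [Algebra ℚ K] [Ring E] [Algebra K E]

theorem refines_nil_iff {I : List ℕ} : Refines I [] ↔ I = [] := by
  constructor
  · rintro ⟨L, rfl, hL⟩
    rw [List.map_eq_nil_iff.mp hL, List.flatten_nil]
  · rintro rfl
    exact ⟨[], rfl, rfl⟩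

theorem Refines.sum_eq {I J : List ℕ} (h : Refines I J) : I.sum = J.sum := by
  obtain ⟨L, rfl, rfl⟩ := h
  exact List.sum_flatten

theorem Refines.cons_iff {I J : List ℕ} {j : ℕ} : Refines I (j :: J) ↔
    ∃ P I', I = P ++ I' ∧ P.sum = j ∧ Refines I' J := by
  constructor
  · rintro ⟨L, rfl, hL⟩
    cases L with
    | nil => simp at hL
    | cons P L =>
      rw [List.map_cons, List.cons.injEq] at hL
      exact ⟨P, L.flatten, List.flatten_cons, hL.1, L, rfl, hL.2⟩
  · rintro ⟨P, I', rfl, rfl, L, rfl, rfl⟩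
    exact ⟨P :: L, by simp, by simp⟩

open Classical in
/-- If every `s_m` is a combination of the products `ψ ^ I` over the compositions `I` of `m`, then
`s ^ J` is a combination of the products `ψ ^ I` over the refinements `I` of `J`. -/
theorem prod_map_eq_sum_refines {s ψ : ℕ → E} (q : List ℕ → ℚ)
    (h : ∀ m, s m = ∑ I ∈ lists m, algebraMap ℚ K (q I) • (I.map ψ).prod) (J : List ℕ) :
    (J.map s).prod = ∑ I ∈ (lists J.sum).filter (Refines · J),
      algebraMap ℚ K ((pieces I J).map q).prod • (I.map ψ).prod := by
  induction J with
  | nil =>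
    rw [Finset.sum_eq_single []]
    · simp [pieces]
    · intro I hI hI'
      exact absurd (refines_nil_iff.mp (Finset.mem_filter.mp hI).2) hI'
    · simp [lists_zero, refines_nil_iff]
  | cons j J ih =>
    rw [List.map_cons, List.prod_cons, ih, h, Finset.sum_mul_sum, ← Finset.sum_product']
    refine Finset.sum_bij (fun x _ => x.1 ++ x.2) ?_ ?_ ?_ ?_
    · rintro ⟨P, I⟩ hx
      simp only [Finset.mem_product, Finset.mem_filter, mem_lists] at hx ⊢
      obtain ⟨⟨h1, h2⟩, ⟨h3, h4⟩, h5⟩ := hx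
      refine ⟨⟨?_, by simp [h2, h4]⟩, Refines.cons_iff.mpr ⟨P, I, rfl, h2, h5⟩⟩
      intro x hx
      exact (List.mem_append.mp hx).elim (h1 x) (h3 x)
    · rintro ⟨P, I⟩ hx ⟨P', I'⟩ hx' heq
      simp only [Finset.mem_product, Finset.mem_filter, mem_lists] at hx hx'
      -- the first piece is determined, because its parts are positive and its sum is `j`
      rw [← splitWeight_append P I hx.1.1, ← splitWeight_append P' I' hx'.1.1, hx.1.2, hx'.1.2]
      exact congrArg _ heq
    · intro I hI
      simp only [Finset.mem_filter, mem_lists] at hI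
      obtain ⟨⟨h1, h2⟩, h3⟩ := hI
      obtain ⟨P, I', rfl, h4, h5⟩ := Refines.cons_iff.mp h3
      refine ⟨(P, I'), ?_, rfl⟩
      simp only [Finset.mem_product, Finset.mem_filter, mem_lists]
      exact ⟨⟨fun x hx => h1 x (List.mem_append_left _ hx), h4⟩,
        ⟨fun x hx => h1 x (List.mem_append_right _ hx), h5.sum_eq⟩, h5⟩
    · rintro ⟨P, I⟩ hx
      simp only [Finset.mem_product, Finset.mem_filter, mem_lists] at hx
      have hp : pieces (P ++ I) (j :: J) = P :: pieces I J := by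
        rw [pieces, ← hx.1.2, splitWeight_append P I hx.1.1]
      rw [hp, smul_mul_smul_comm, ← map_mul, List.map_cons, List.prod_cons, List.map_append,
        List.prod_append]

theorem prod_map_pieces_one_div_piU (I J : List ℕ) :
    ((pieces I J).map fun P => 1 / (piU P : ℚ)).prod = 1 / (piU₂ I J : ℚ) := by
  rw [piU₂]
  induction pieces I J with
  | nil => simp
  | cons P L ih =>
    rw [List.map_cons, List.prod_cons, ih, List.map_cons, List.prod_cons, Nat.cast_mul,
      one_div_mul_one_div]

theorem pieces_reverse {I J : List ℕ} (hI : ∀ x ∈ I, 0 < x) (h : Refines I J) :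
    pieces I.reverse J.reverse = ((pieces I J).map List.reverse).reverse := by
  obtain ⟨L, rfl, rfl⟩ := h
  have h1 : L.flatten.reverse = ((L.map List.reverse).reverse).flatten := List.reverse_flatten
  have h2 : (L.map List.sum).reverse = ((L.map List.reverse).reverse).map List.sum := by
    rw [List.map_reverse, List.map_map]
    congr 2
    funext P
    exact (List.sum_reverse P).symm
  rw [pieces_eq L hI, h2, h1, pieces_eq]
  intro x hx
  rw [← h1] at hx
  exact hI x (List.mem_reverse.mp hx)

theorem prod_map_pieces_one_div_piU_reverse {I J : List ℕ} (hI : ∀ x ∈ I, 0 < x)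
    (h : Refines I J) : ((pieces I J).map fun P => 1 / (piU P.reverse : ℚ)).prod =
      1 / (piU₂ I.reverse J.reverse : ℚ) := by
  rw [← prod_map_pieces_one_div_piU, pieces_reverse hI h, List.map_reverse, List.prod_reverse,
    List.map_map]
  rfl

open Classical in
/-- A combination of the products `s ^ J` over the compositions `J` of `m`, rewritten in terms of
the products `ψ ^ I`. -/
theorem sum_prod_map_eq_sum_refines {s ψ : ℕ → E} (q : List ℕ → ℚ)
    (h : ∀ m, s m = ∑ I ∈ lists m, algebraMap ℚ K (q I) • (I.map ψ).prod) (m : ℕ)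
    (b : List ℕ → ℚ) : ∑ J ∈ lists m, algebraMap ℚ K (b J) • (J.map s).prod =
      ∑ I ∈ lists m, algebraMap ℚ K (∑ J ∈ (lists m).filter (Refines I),
        b J * ((pieces I J).map q).prod) • (I.map ψ).prod := by
  simp only [map_sum, Finset.sum_smul, Finset.sum_filter]
  rw [Finset.sum_comm]
  refine Finset.sum_congr rfl fun J hJ => ?_
  rw [prod_map_eq_sum_refines q h J, (mem_lists.mp hJ).2, Finset.smul_sum, Finset.sum_filter]
  refine Finset.sum_congr rfl fun I _ => ?_
  split_ifs
  · rw [smul_smul, ← map_mul]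
  · rw [map_zero, zero_smul]

end refinements

end Compo

/-! ### Multiplication by the variables -/

namespace MvPowerSeries

variable {n : ℕ} {R : Type*} [CommRing R]

theorem coeff_X_mul' (v : Fin n →₀ ℕ) (i : Fin n) (g : MvPowerSeries (Fin n) R) :
    coeff v (X i * g) =
      if Finsupp.single i 1 ≤ v then coeff (v - Finsupp.single i 1) g else 0 := by
  rw [X, coeff_monomial_mul, one_mul]

theorem exists_eq_add_sum_X_mul (u : MvPowerSeries (Fin n) R) :
    ∃ (r : R) (g : Fin n → MvPowerSeries (Fin n) R), u = r • 1 + ∑ i, X i * g i := by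
  classical
  -- `X i * g i` collects the monomials whose first variable is `X i`
  let g : Fin n → MvPowerSeries (Fin n) R := fun i v =>
    if ∀ j < i, v j = 0 then coeff (v + Finsupp.single i 1) u else 0
  refine ⟨constantCoeff u, g, MvPowerSeries.ext fun v => ?_⟩
  rw [map_add, map_sum, coeff_smul, coeff_one]
  have h : ∀ i : Fin n, coeff v (X i * g i) =
      if v i ≠ 0 ∧ ∀ j < i, v j = 0 then coeff v u else 0 := by
    intro i
    rw [coeff_X_mul']
    by_cases hi : v i = 0
    · rw [if_neg, if_neg (fun h => h.1 hi)]
      rw [Finsupp.single_le_iff]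
      omega
    · have hle : Finsupp.single i 1 ≤ v := by
        rw [Finsupp.single_le_iff]
        omega
      rw [if_pos hle]
      change (if ∀ j < i, (v - Finsupp.single i 1 : Fin n →₀ ℕ) j = 0 then
        coeff (v - Finsupp.single i 1 + Finsupp.single i 1) u else 0) = _
      rw [tsub_add_cancel_of_le hle]
      refine if_congr ?_ rfl rfl
      simp only [ne_eq, hi, not_false_eq_true, true_and]
      refine forall₂_congr fun j hj => ?_
      rw [Finsupp.tsub_apply, Finsupp.single_eq_of_ne (by exact hj.ne), tsub_zero]
  rw [Finset.sum_congr rfl fun i _ => h i]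
  by_cases hv : v = 0
  · simp [hv]
  · have hex : ∃ i, v i ≠ 0 := by
      by_contra hcon
      push Not at hcon
      exact hv (Finsupp.ext hcon)
    obtain ⟨i, hi, hmin⟩ : ∃ i, v i ≠ 0 ∧ ∀ j < i, v j = 0 := by
      obtain ⟨i, hi, hmin⟩ := WellFounded.has_min (wellFounded_lt (α := Fin n)) {i | v i ≠ 0} hex
      exact ⟨i, hi, fun j hj => by_contra fun hj' => hmin j hj' hj⟩
    rw [if_neg hv, mul_zero, zero_add, Finset.sum_eq_single i]
    · rw [if_pos ⟨hi, hmin⟩]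
    · rintro j - hj
      refine if_neg fun h' => ?_
      rcases lt_or_gt_of_ne hj with hlt | hgt
      · exact h'.1 (hmin j hlt)
      · exact hi (h'.2 i hgt)
    · simp

end MvPowerSeries

namespace NCPowerSeries

variable {n : ℕ} {R : Type*} [CommRing R]

theorem X_mul_nil (i : Fin n) (g : NCPowerSeries (Fin n) R) :
    (X i * g : NCPowerSeries (Fin n) R) [] = 0 := by
  simp [mul_nil, X]

theorem X_mul_cons (i : Fin n) (g : NCPowerSeries (Fin n) R) (j : Fin n) (w : List (Fin n)) :
    (X i * g : NCPowerSeries (Fin n) R) (j :: w) = if j = i then g w else 0 := by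
  have h : tail j (X i : NCPowerSeries (Fin n) R) = if j = i then 1 else 0 := by
    apply ext'
    intro w
    by_cases hj : j = i
    · subst hj
      cases w <;> simp [tail, X, one_nil, one_cons]
    · simp [tail, X, hj, zero_apply]
  rw [mul_cons, h]
  split_ifs <;> simp [X, zero_apply]

theorem exists_eq_add_sum_X_mul (u : NCPowerSeries (Fin n) R) :
    ∃ (r : R) (g : Fin n → NCPowerSeries (Fin n) R), u = r • 1 + ∑ i, X i * g i := by
  refine ⟨u [], fun i => tail i u, ext' fun w => ?_⟩
  rw [add_apply, smul_apply, sum_apply]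
  cases w with
  | nil => simp [X_mul_nil, one_nil]
  | cons j w => simp [X_mul_cons, one_cons, tail]

end NCPowerSeries

namespace FPS

/-! ### Coefficients of products, and rigidity of derivations and homomorphisms -/

section rigidity

variable {c : VarKind} {n : ℕ} {R : Type u} [CommRing R]

theorem coeff_zero (w : Mono c n) : coeff w (0 : FPS c n R) = 0 := by
  cases c <;> rfl

/-- The coefficients as additive maps. -/
def coeffHom (w : Mono c n) : FPS c n R →+ R where
  toFun := coeff w
  map_zero' := coeff_zero w
  map_add' := coeff_add w

theorem coeff_sum {ι : Type*} (w : Mono c n) (s : Finset ι) (f : ι → FPS c n R) :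
    coeff w (∑ i ∈ s, f i) = ∑ i ∈ s, coeff w (f i) :=
  map_sum (coeffHom w) f s

/-- The coefficient of a monomial in a product is the sum over the finitely many ways to write the
monomial as a product, whatever the ring of coefficients is. -/
theorem exists_coeff_mul (w : Mono c n) : ∃ s : Finset (Mono c n × Mono c n),
    ∀ (R : Type u) [CommRing R] (f g : FPS c n R),
      coeff w (f * g) = ∑ p ∈ s, coeff p.1 f * coeff p.2 g := by
  classical
  cases c
  · exact ⟨Finset.HasAntidiagonal.antidiagonal (A := Fin n →₀ ℕ) w,
      fun R _ f g => MvPowerSeries.coeff_mul (R := R) (σ := Fin n) w f g⟩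
  · let v : List (Fin n) := w
    refine ⟨(Finset.range (v.length + 1)).image fun k => (v.take k, v.drop k), fun R _ f g => ?_⟩
    refine Eq.trans ?_ (Finset.sum_image ?_).symm
    · rfl
    · intro k hk l hl h
      have h1 := congrArg (fun p : List (Fin n) × List (Fin n) => p.1.length) h
      simp at hk hl h1
      omega

theorem coeff_X_mul_eq_zero {k : ℕ} {f : FPS c n R} (h : ∀ w, w.degree < k → coeff w f = 0)
    (i : Fin n) (w : Mono c n) (hw : w.degree < k + 1) : coeff w (X i * f) = 0 := by
  cases c
  · let v : Fin n →₀ ℕ := w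
    refine (MvPowerSeries.coeff_X_mul' v i (show MvPowerSeries (Fin n) R from f)).trans ?_
    split_ifs with hv
    · refine h (show Mono .comm n from (v - Finsupp.single i 1 : Fin n →₀ ℕ)) ?_
      change Finsupp.degree (v - Finsupp.single i 1) < k
      have h2 := congrArg Finsupp.degree (tsub_add_cancel_of_le hv)
      have h3 : Finsupp.degree v < k + 1 := hw
      rw [map_add, Finsupp.degree_single] at h2
      omega
    · rfl
  · let g : NCPowerSeries (Fin n) R := f
    have key : ∀ v : List (Fin n), v.length < k + 1 →
        (NCPowerSeries.X i * g : NCPowerSeries (Fin n) R) v = 0 := by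
      intro v hv
      cases v with
      | nil => exact NCPowerSeries.X_mul_nil i g
      | cons j v =>
        rw [NCPowerSeries.X_mul_cons]
        split_ifs
        · exact h (show Mono .noncomm n from v) (show v.length < k by simpa using hv)
        · rfl
    exact key w hw

theorem exists_eq_add_sum_X_mul (u : FPS c n R) :
    ∃ (r : R) (g : Fin n → FPS c n R), u = r • 1 + ∑ i, X i * g i := by
  cases c
  · exact MvPowerSeries.exists_eq_add_sum_X_mul u
  · exact NCPowerSeries.exists_eq_add_sum_X_mul u

/-- A linear map that kills `1` and commutes with the multiplications by the variables vanishes: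
it raises the order in `z` of every series by as much as one likes. -/
theorem eq_zero_of_map_X_mul (T : Module.End R (FPS c n R)) (h1 : T 1 = 0)
    (hX : ∀ i f, T (X i * f) = X i * T f) : T = 0 := by
  have key : ∀ k : ℕ, ∀ u w, w.degree < k → coeff w (T u) = 0 := by
    intro k
    induction k with
    | zero => intro u w hw; omega
    | succ k ih =>
      intro u w hw
      obtain ⟨r, g, rfl⟩ := exists_eq_add_sum_X_mul u
      rw [map_add, map_smul, h1, smul_zero, zero_add, map_sum, coeff_sum]
      refine Finset.sum_eq_zero fun i _ => ?_
      rw [hX]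
      exact coeff_X_mul_eq_zero (ih (g i)) i w hw
  refine LinearMap.ext fun u => ext fun w => ?_
  rw [key (w.degree + 1) u w (by omega), LinearMap.zero_apply, coeff_zero]

theorem map_one_of_leibniz {D : Module.End R (FPS c n R)}
    (hD : ∀ u v, D (u * v) = D u * v + u * D v) : D 1 = 0 := by
  simpa using hD 1 1

/-- Derivations of `R⟨⟨z⟩⟩` are determined by their values on the variables. -/
theorem eq_of_leibniz {D D' : Module.End R (FPS c n R)}
    (hD : ∀ u v, D (u * v) = D u * v + u * D v) (hD' : ∀ u v, D' (u * v) = D' u * v + u * D' v)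
    (h : ∀ i, D (X i) = D' (X i)) : D = D' := by
  refine sub_eq_zero.mp (eq_zero_of_map_X_mul (D - D') ?_ fun i f => ?_)
  · rw [LinearMap.sub_apply, map_one_of_leibniz hD, map_one_of_leibniz hD', sub_zero]
  · rw [LinearMap.sub_apply, LinearMap.sub_apply, hD, hD', h, mul_sub, add_sub_add_left_eq_sub]

/-- Endomorphisms of the algebra `R⟨⟨z⟩⟩` that fix the variables are trivial. -/
theorem eq_one_of_map_mul {φ : Module.End R (FPS c n R)} (h1 : φ 1 = 1)
    (hφ : ∀ u v, φ (u * v) = φ u * φ v) (h : ∀ i, φ (X i) = X i) : φ = 1 := by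
  refine sub_eq_zero.mp (eq_zero_of_map_X_mul (φ - 1) ?_ fun i f => ?_)
  · rw [LinearMap.sub_apply, h1, Module.End.one_apply, sub_self]
  · rw [LinearMap.sub_apply, LinearMap.sub_apply, hφ, h, mul_sub, Module.End.one_apply,
      Module.End.one_apply]

end rigidity


open Finset.HasAntidiagonal (antidiagonal mem_antidiagonal)

variable {c : VarKind} {n : ℕ} {K : Type u} [CommRing K]

/-! ### Expansion in the parameter -/

section parameter

theorem coeff_tCoeff (m : ℕ) (w : Mono c n) (f : FPS c n K⟦X⟧) :
    coeff w (tCoeff m f) = PowerSeries.coeff m (coeff w f) :=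
  coeff_ofCoeff _ _

theorem tExt {f g : FPS c n K⟦X⟧} (h : ∀ m, tCoeff m f = tCoeff m g) : f = g :=
  ext fun w => PowerSeries.ext fun m => by rw [← coeff_tCoeff, ← coeff_tCoeff, h]

/-- The coefficient of `t ^ m` as an additive map. -/
noncomputable def tCoeffHom (m : ℕ) : FPS c n K⟦X⟧ →+ FPS c n K where
  toFun := tCoeff m
  map_zero' := ext fun w => by rw [coeff_tCoeff, coeff_zero, coeff_zero, map_zero]
  map_add' f g := ext fun w => by
    rw [coeff_tCoeff, coeff_add, coeff_add, map_add, coeff_tCoeff, coeff_tCoeff]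

theorem tCoeff_zero (m : ℕ) : tCoeff m (0 : FPS c n K⟦X⟧) = 0 := map_zero (tCoeffHom m)

theorem tCoeff_add (m : ℕ) (f g : FPS c n K⟦X⟧) : tCoeff m (f + g) = tCoeff m f + tCoeff m g :=
  map_add (tCoeffHom m) f g

theorem tCoeff_neg (m : ℕ) (f : FPS c n K⟦X⟧) : tCoeff m (-f) = -tCoeff m f :=
  map_neg (tCoeffHom m) f

theorem tCoeff_sub (m : ℕ) (f g : FPS c n K⟦X⟧) : tCoeff m (f - g) = tCoeff m f - tCoeff m g :=
  map_sub (tCoeffHom m) f g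

theorem tCoeff_sum {ι : Type*} (m : ℕ) (s : Finset ι) (f : ι → FPS c n K⟦X⟧) :
    tCoeff m (∑ i ∈ s, f i) = ∑ i ∈ s, tCoeff m (f i) :=
  map_sum (tCoeffHom m) f s

theorem tCoeff_smul (m : ℕ) (r : K⟦X⟧) (f : FPS c n K⟦X⟧) : tCoeff m (r • f) =
    ∑ x ∈ antidiagonal m, PowerSeries.coeff x.1 r • tCoeff x.2 f :=
  ext fun w => by
    rw [coeff_tCoeff, coeff_smul, PowerSeries.coeff_mul, coeff_sum]
    simp only [coeff_smul, coeff_tCoeff]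

theorem tCoeff_mul (m : ℕ) (f g : FPS c n K⟦X⟧) :
    tCoeff m (f * g) = ∑ x ∈ antidiagonal m, tCoeff x.1 f * tCoeff x.2 g :=
  ext fun w => by
    obtain ⟨s, hs⟩ := exists_coeff_mul.{u} w
    rw [coeff_tCoeff, hs, coeff_sum, map_sum]
    simp only [hs, coeff_tCoeff, PowerSeries.coeff_mul]
    exact Finset.sum_comm

theorem tCoeff_tSeries (m : ℕ) (b : ℕ → FPS c n K) : tCoeff m (tSeries b) = b m :=
  ext fun w => by rw [coeff_tCoeff, tSeries, coeff_ofCoeff, PowerSeries.coeff_mk]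

theorem tCoeff_tConst (m : ℕ) (u : FPS c n K) :
    tCoeff m (tConst u) = if m = 0 then u else 0 :=
  ext fun w => by
    rw [coeff_tCoeff, tConst, coeff_ofCoeff, PowerSeries.coeff_C]
    split_ifs
    · rfl
    · rw [coeff_zero]

theorem tCoeff_zero_tConst (u : FPS c n K) : tCoeff 0 (tConst u) = u := by
  rw [tCoeff_tConst, if_pos rfl]

/-- The coefficients of `1` are `0` or `1`, uniformly in the ring of coefficients. -/
theorem coeff_one_eq (w : Mono c n) : (∀ (R : Type u) [CommRing R], coeff w (1 : FPS c n R) = 1) ∨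
    ∀ (R : Type u) [CommRing R], coeff w (1 : FPS c n R) = 0 := by
  classical
  cases c
  · have h : ∀ (R : Type u) [CommRing R], coeff w (1 : FPS .comm n R) =
        if w = (0 : Fin n →₀ ℕ) then 1 else 0 := fun R _ =>
      (MvPowerSeries.coeff_one (R := R) (σ := Fin n) w).trans (by congr)
    by_cases hw : w = (0 : Fin n →₀ ℕ)
    · exact Or.inl fun R _ => by rw [h, if_pos hw]
    · exact Or.inr fun R _ => by rw [h, if_neg hw]
  · cases w with
    | nil => exact Or.inl fun R _ => rfl
    | cons i w => exact Or.inr fun R _ => rfl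

/-- The coefficients of a variable are `0` or `1`, uniformly in the ring of coefficients. -/
theorem coeff_X_eq (i : Fin n) (w : Mono c n) :
    (∀ (R : Type u) [CommRing R], coeff w (X i : FPS c n R) = 1) ∨
      ∀ (R : Type u) [CommRing R], coeff w (X i : FPS c n R) = 0 := by
  classical
  cases c
  · have h : ∀ (R : Type u) [CommRing R], coeff w (X i : FPS .comm n R) =
        if w = (Finsupp.single i 1 : Fin n →₀ ℕ) then 1 else 0 := fun R _ =>
      (MvPowerSeries.coeff_X (R := R) (σ := Fin n) w i).trans (by congr)
    by_cases hw : w = (Finsupp.single i 1 : Fin n →₀ ℕ)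
    · exact Or.inl fun R _ => by rw [h, if_pos hw]
    · exact Or.inr fun R _ => by rw [h, if_neg hw]
  · by_cases hw : w = ([i] : List (Fin n))
    · exact Or.inl fun R _ => if_pos hw
    · exact Or.inr fun R _ => if_neg hw

theorem tConst_one : (tConst 1 : FPS c n K⟦X⟧) = 1 :=
  ext fun w => by
    rw [tConst, coeff_ofCoeff]
    rcases coeff_one_eq.{u} w with h | h <;> simp [h]

theorem tConst_X (i : Fin n) : (tConst (X i) : FPS c n K⟦X⟧) = X i :=
  ext fun w => by
    rw [tConst, coeff_ofCoeff]
    rcases coeff_X_eq.{u} i w with h | h <;> simp [h]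

theorem tConst_mul (u v : FPS c n K) : (tConst (u * v) : FPS c n K⟦X⟧) = tConst u * tConst v :=
  ext fun w => by
    obtain ⟨s, hs⟩ := exists_coeff_mul.{u} w
    simp only [tConst, coeff_ofCoeff, hs, map_sum, map_mul]

theorem tCoeff_mul_tConst (m : ℕ) (f : FPS c n K⟦X⟧) (v : FPS c n K) :
    tCoeff m (f * tConst v) = tCoeff m f * v := by
  rw [tCoeff_mul, Finset.sum_eq_single (m, 0)]
  · rw [tCoeff_zero_tConst]
  · rintro ⟨i, j⟩ h h'
    rw [tCoeff_tConst, if_neg, mul_zero]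
    rintro rfl
    rw [mem_antidiagonal] at h
    exact h' (by rw [← h]; rfl)
  · intro h
    exact absurd (mem_antidiagonal.mpr (add_zero m)) h

theorem tCoeff_tConst_mul (m : ℕ) (u : FPS c n K) (f : FPS c n K⟦X⟧) :
    tCoeff m (tConst u * f) = u * tCoeff m f := by
  rw [tCoeff_mul, Finset.sum_eq_single (0, m)]
  · rw [tCoeff_zero_tConst]
  · rintro ⟨i, j⟩ h h'
    rw [tCoeff_tConst, if_neg, zero_mul]
    rintro rfl
    rw [mem_antidiagonal] at h
    exact h' (by rw [← h, zero_add])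
  · intro h
    exact absurd (mem_antidiagonal.mpr (zero_add m)) h

theorem tCoeff_X_smul_zero (f : FPS c n K⟦X⟧) :
    tCoeff 0 ((PowerSeries.X : K⟦X⟧) • f) = 0 :=
  ext fun w => by rw [coeff_tCoeff, coeff_smul, PowerSeries.coeff_zero_X_mul, coeff_zero]

theorem tCoeff_X_smul_succ (m : ℕ) (f : FPS c n K⟦X⟧) :
    tCoeff (m + 1) ((PowerSeries.X : K⟦X⟧) • f) = tCoeff m f :=
  ext fun w => by rw [coeff_tCoeff, coeff_smul, PowerSeries.coeff_succ_X_mul, coeff_tCoeff]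

theorem eq_tConst_add_X_smul (f : FPS c n K⟦X⟧) : f = tConst (tCoeff 0 f) +
    (PowerSeries.X : K⟦X⟧) • tSeries fun m => tCoeff (m + 1) f := by
  refine tExt fun m => ?_
  cases m with
  | zero => rw [tCoeff_add, tCoeff_zero_tConst, tCoeff_X_smul_zero, add_zero]
  | succ m =>
    rw [tCoeff_add, tCoeff_tConst, if_neg m.succ_ne_zero, tCoeff_X_smul_succ, tCoeff_tSeries,
      zero_add]

theorem tCoeff_tDeriv (m : ℕ) (f : FPS c n K⟦X⟧) :
    tCoeff m (tDeriv f) = ((m + 1 : ℕ) : K) • tCoeff (m + 1) f :=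
  ext fun w => by
    rw [coeff_tCoeff, tDeriv, coeff_ofCoeff, PowerSeries.coeff_derivative, coeff_smul,
      coeff_tCoeff, mul_comm, Nat.cast_succ]

theorem tDeriv_add (f g : FPS c n K⟦X⟧) : tDeriv (f + g) = tDeriv f + tDeriv g :=
  ext fun w => by
    rw [coeff_add]
    simp only [tDeriv, coeff_ofCoeff, coeff_add, map_add]

theorem tDeriv_neg (f : FPS c n K⟦X⟧) : tDeriv (-f) = -tDeriv f := by
  refine eq_neg_of_add_eq_zero_left ?_
  rw [← tDeriv_add, neg_add_cancel]
  exact ext fun w => by simp [tDeriv, coeff_ofCoeff, coeff_zero]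

theorem tDeriv_smul (r : K⟦X⟧) (f : FPS c n K⟦X⟧) :
    tDeriv (r • f) = PowerSeries.derivative K r • f + r • tDeriv f :=
  ext fun w => by
    simp only [tDeriv, coeff_ofCoeff, coeff_add, coeff_smul, Derivation.leibniz, smul_eq_mul]
    ring

theorem tDeriv_mul (f g : FPS c n K⟦X⟧) : tDeriv (f * g) = tDeriv f * g + f * tDeriv g :=
  ext fun w => by
    obtain ⟨s, hs⟩ := exists_coeff_mul.{u} w
    simp only [tDeriv, coeff_ofCoeff, coeff_add, hs, map_sum, Derivation.leibniz, smul_eq_mul]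
    rw [← Finset.sum_add_distrib]
    exact Finset.sum_congr rfl fun p _ => by ring

theorem tDeriv_tConst (u : FPS c n K) : tDeriv (tConst u : FPS c n K⟦X⟧) = 0 :=
  ext fun w => by
    rw [tDeriv, coeff_ofCoeff, tConst, coeff_ofCoeff, PowerSeries.derivative_C, coeff_zero]

end parameter

/-! ### Operators as power series in the parameter -/

section operators

theorem opCoeff_apply (P : Module.End K⟦X⟧ (FPS c n K⟦X⟧)) (m : ℕ) (u : FPS c n K) :
    opCoeff P m u = tCoeff m (P (tConst u)) := rfl

/-- A `K[[t]]`-linear operator is determined by its coefficients, as it is automatically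
`t`-adically continuous. -/
theorem tCoeff_map (P : Module.End K⟦X⟧ (FPS c n K⟦X⟧)) (m : ℕ) (f : FPS c n K⟦X⟧) :
    tCoeff m (P f) = ∑ x ∈ antidiagonal m, opCoeff P x.1 (tCoeff x.2 f) := by
  induction m generalizing f with
  | zero =>
    conv_lhs => rw [eq_tConst_add_X_smul f, map_add, map_smul, tCoeff_add, tCoeff_X_smul_zero]
    simp [opCoeff_apply]
  | succ m ih =>
    conv_lhs => rw [eq_tConst_add_X_smul f, map_add, map_smul, tCoeff_add, tCoeff_X_smul_succ, ih]
    rw [Finset.Nat.sum_antidiagonal_succ', add_comm, add_comm]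
    simp only [tCoeff_tSeries, opCoeff_apply]

/-- The operator with given coefficients `D_m` is linear over `K[[t]]`. -/
theorem tCoeff_sum_antidiagonal_smul (D : ℕ → Module.End K (FPS c n K)) (r : K⟦X⟧)
    (f : FPS c n K⟦X⟧) (m : ℕ) :
    ∑ x ∈ antidiagonal m, D x.1 (tCoeff x.2 (r • f)) =
      ∑ x ∈ antidiagonal m, PowerSeries.coeff x.1 r •
        ∑ y ∈ antidiagonal x.2, D y.1 (tCoeff y.2 f) := by
  simp only [tCoeff_smul, map_sum, map_smul, Finset.smul_sum]
  rw [Finset.sum_sigma', Finset.sum_sigma']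
  refine Finset.sum_bij' (fun x _ => ⟨(x.2.1, x.1.1 + x.2.2), (x.1.1, x.2.2)⟩)
    (fun x _ => ⟨(x.2.1, x.1.1 + x.2.2), (x.1.1, x.2.2)⟩) ?_ ?_ ?_ ?_ ?_
  all_goals
    rintro ⟨⟨a, b⟩, ⟨d, e⟩⟩ h
    simp only [Finset.mem_sigma, mem_antidiagonal] at h
    obtain ⟨h1, h2⟩ := h
    first
      | (subst h2; rfl)
      | exact Finset.mem_sigma.mpr ⟨mem_antidiagonal.mpr (by dsimp only; omega),
          mem_antidiagonal.mpr rfl⟩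

/-- The operators on `K[[t]]⟨⟨z⟩⟩` that are linear over `K[[t]]` are the power series of operators
on `K⟨⟨z⟩⟩`. -/
noncomputable def opSeries : Module.End K⟦X⟧ (FPS c n K⟦X⟧) ≃+* (Module.End K (FPS c n K))⟦X⟧ where
  toFun P := PowerSeries.mk (opCoeff P)
  invFun D :=
    { toFun := fun f => tSeries fun m =>
        ∑ x ∈ antidiagonal m, PowerSeries.coeff x.1 D (tCoeff x.2 f)
      map_add' := fun f g => tExt fun m => by
        simp only [tCoeff_add, tCoeff_tSeries, map_add, Finset.sum_add_distrib]
      map_smul' := fun r f => tExt fun m => by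
        rw [tCoeff_tSeries, tCoeff_sum_antidiagonal_smul fun m => PowerSeries.coeff m D,
          RingHom.id_apply, tCoeff_smul]
        simp only [tCoeff_tSeries] }
  left_inv P := LinearMap.ext fun f => tExt fun m => by
    simp only [PowerSeries.coeff_mk, LinearMap.coe_mk, AddHom.coe_mk, tCoeff_tSeries, tCoeff_map]
  right_inv D := PowerSeries.ext fun m => LinearMap.ext fun u => by
    rw [PowerSeries.coeff_mk, opCoeff_apply, LinearMap.coe_mk, AddHom.coe_mk, tCoeff_tSeries,
      Finset.sum_eq_single (m, 0)]
    · rw [tCoeff_zero_tConst]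
    · rintro ⟨i, j⟩ h h'
      rw [tCoeff_tConst, if_neg, map_zero]
      rintro rfl
      rw [mem_antidiagonal] at h
      exact h' (by rw [← h]; rfl)
    · intro h
      exact absurd (mem_antidiagonal.mpr (add_zero m)) h
  map_mul' P Q := PowerSeries.ext fun m => LinearMap.ext fun u => by
    rw [PowerSeries.coeff_mk, PowerSeries.coeff_mul, LinearMap.sum_apply, opCoeff_apply,
      Module.End.mul_apply, tCoeff_map]
    simp only [PowerSeries.coeff_mk, Module.End.mul_apply, opCoeff_apply]
  map_add' P Q := PowerSeries.ext fun m => LinearMap.ext fun u => by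
    rw [map_add, LinearMap.add_apply]
    simp only [PowerSeries.coeff_mk, opCoeff_apply, LinearMap.add_apply, tCoeff_add]

theorem coeff_opSeries (P : Module.End K⟦X⟧ (FPS c n K⟦X⟧)) (m : ℕ) :
    PowerSeries.coeff m (opSeries P) = opCoeff P m :=
  PowerSeries.coeff_mk m (opCoeff P)

theorem constantCoeff_opSeries (P : Module.End K⟦X⟧ (FPS c n K⟦X⟧)) :
    PowerSeries.constantCoeff (opSeries P) = opCoeff P 0 := by
  rw [← PowerSeries.coeff_zero_eq_constantCoeff_apply, coeff_opSeries]

theorem opCoeff_mul (P Q : Module.End K⟦X⟧ (FPS c n K⟦X⟧)) (m : ℕ) :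
    opCoeff (P * Q) m = ∑ x ∈ antidiagonal m, opCoeff P x.1 * opCoeff Q x.2 := by
  simp only [← coeff_opSeries, map_mul, PowerSeries.coeff_mul]

variable [Algebra ℚ K]

/-- `expApply` computes the exponential of a power series of operators. -/
theorem expApply_eq {D : Module.End K⟦X⟧ (FPS c n K⟦X⟧)} (hD : opCoeff D 0 = 0)
    (u : FPS c n K⟦X⟧) : expApply D u =
      opSeries.symm (PowerSeries.evalAt (opSeries D) (PowerSeries.exp K)) u := by
  have hD' : PowerSeries.constantCoeff (opSeries D) = 0 := by rw [constantCoeff_opSeries, hD]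
  refine tExt fun m => ?_
  rw [tCoeff_map, expApply, tCoeff_tSeries]
  simp only [tCoeff_map (D ^ _), Finset.smul_sum]
  rw [Finset.sum_comm]
  refine Finset.sum_congr rfl fun x hx => ?_
  have hx' := mem_antidiagonal.mp hx
  rw [← coeff_opSeries, RingEquiv.apply_symm_apply,
    PowerSeries.coeff_evalAt_of_lt hD' _ (show x.1 < m + 1 by omega), LinearMap.sum_apply]
  refine Finset.sum_congr rfl fun k _ => ?_
  rw [PowerSeries.coeff_exp, LinearMap.smul_apply, ← map_pow, coeff_opSeries]

theorem forall_expApply_eq_iff {D P : Module.End K⟦X⟧ (FPS c n K⟦X⟧)} (hD : opCoeff D 0 = 0) :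
    (∀ u, expApply D u = P u) ↔
      PowerSeries.evalAt (opSeries D) (PowerSeries.exp K) = opSeries P := by
  rw [← RingEquiv.symm_apply_eq, LinearMap.ext_iff]
  simp only [expApply_eq hD]

end operators

/-! ### Operators whose exponential is multiplicative -/

section multiplicative

/-- The series divisible by `t ^ m`. -/
noncomputable def tFilt (m : ℕ) : AddSubgroup (FPS c n K⟦X⟧) where
  carrier := {f | ∀ j < m, tCoeff j f = 0}
  zero_mem' j _ := tCoeff_zero j
  add_mem' hf hg j hj := by rw [tCoeff_add, hf j hj, hg j hj, add_zero]
  neg_mem' hf j hj := by rw [tCoeff_neg, hf j hj, neg_zero]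

theorem X_smul_mem_tFilt {m : ℕ} {f : FPS c n K⟦X⟧} (hf : f ∈ tFilt m) :
    (PowerSeries.X : K⟦X⟧) • f ∈ tFilt (m + 1) := by
  intro j hj
  cases j with
  | zero => exact tCoeff_X_smul_zero f
  | succ j => rw [tCoeff_X_smul_succ, hf j (by omega)]

theorem mul_mem_tFilt {k l : ℕ} {f g : FPS c n K⟦X⟧} (hf : f ∈ tFilt k) (hg : g ∈ tFilt l) :
    f * g ∈ tFilt (k + l) := by
  intro j hj
  rw [tCoeff_mul]
  refine Finset.sum_eq_zero fun x hx => ?_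
  have hx' := mem_antidiagonal.mp hx
  rcases lt_or_ge x.1 k with h | h
  · rw [hf x.1 h, zero_mul]
  · rw [hg x.2 (by omega), mul_zero]

variable {D : Module.End K⟦X⟧ (FPS c n K⟦X⟧)}

theorem exists_map_eq_X_smul (hD : opCoeff D 0 = 0) (u : FPS c n K⟦X⟧) :
    ∃ v, D u = (PowerSeries.X : K⟦X⟧) • v := by
  refine ⟨tSeries fun m => tCoeff (m + 1) (D u), ?_⟩
  have h : (tConst 0 : FPS c n K⟦X⟧) = 0 :=
    tExt fun m => by rw [tCoeff_tConst, tCoeff_zero, ite_self]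
  conv_lhs => rw [eq_tConst_add_X_smul (D u), tCoeff_map]
  simp [hD, h]

theorem map_mem_tFilt (hD : opCoeff D 0 = 0) {m : ℕ} {f : FPS c n K⟦X⟧} (hf : f ∈ tFilt m) :
    D f ∈ tFilt (m + 1) := by
  intro j hj
  rw [tCoeff_map]
  refine Finset.sum_eq_zero fun x hx => ?_
  have hx' := mem_antidiagonal.mp hx
  rcases Nat.eq_zero_or_pos x.1 with h | h
  · rw [h, hD, LinearMap.zero_apply]
  · rw [hf x.2 (by omega), map_zero]

theorem pow_map_mem_tFilt (hD : opCoeff D 0 = 0) (k : ℕ) (u : FPS c n K⟦X⟧) :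
    (D ^ k) u ∈ tFilt k := by
  induction k with
  | zero => intro j hj; omega
  | succ k ih =>
    rw [pow_succ', Module.End.mul_apply]
    exact map_mem_tFilt hD ih

/-- The failure of the Leibniz rule for `D ^ k`. -/
noncomputable def leibnizDefect (D : Module.End K⟦X⟧ (FPS c n K⟦X⟧)) (k : ℕ) (u v : FPS c n K⟦X⟧) :
    FPS c n K⟦X⟧ :=
  (D ^ k) (u * v) - ∑ x ∈ antidiagonal k, k.choose x.1 • ((D ^ x.1) u * (D ^ x.2) v)

theorem leibnizDefect_one (u v : FPS c n K⟦X⟧) :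
    leibnizDefect D 1 u v = D (u * v) - (D u * v + u * D v) := by
  simp [leibnizDefect, Finset.Nat.antidiagonal_succ, add_comm]

theorem leibnizDefect_succ (k : ℕ) (u v : FPS c n K⟦X⟧) :
    leibnizDefect D (k + 1) u v = D (leibnizDefect D k u v) +
      ∑ x ∈ antidiagonal k, k.choose x.1 • leibnizDefect D 1 ((D ^ x.1) u) ((D ^ x.2) v) := by
  have h := Finset.sum_antidiagonal_choose_succ_nsmul (fun i j => (D ^ i) u * (D ^ j) v) k
  have h' : ∀ x ∈ antidiagonal k, k.choose x.2 • ((D ^ (x.1 + 1)) u * (D ^ x.2) v) =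
      k.choose x.1 • ((D ^ (x.1 + 1)) u * (D ^ x.2) v) := by
    intro x hx
    rw [← mem_antidiagonal.mp hx, Nat.choose_symm_add]
  rw [leibnizDefect, h, Finset.sum_congr rfl h', leibnizDefect, map_sub, map_sum]
  simp only [leibnizDefect_one, smul_sub, smul_add, Finset.sum_sub_distrib, map_nsmul,
    Finset.sum_add_distrib, pow_succ', Module.End.mul_apply]
  abel

theorem leibnizDefect_one_smul_left (u v : FPS c n K⟦X⟧) (r : K⟦X⟧) :
    leibnizDefect D 1 (r • u) v = r • leibnizDefect D 1 u v := by
  simp only [leibnizDefect_one, smul_mul_assoc, map_smul, smul_sub, smul_add]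

theorem leibnizDefect_one_smul_right (u v : FPS c n K⟦X⟧) (r : K⟦X⟧) :
    leibnizDefect D 1 u (r • v) = r • leibnizDefect D 1 u v := by
  simp only [leibnizDefect_one, mul_smul_comm, map_smul, smul_sub, smul_add]

/-- The Leibniz rule for the higher powers of `D` holds to a higher order in `t` than that for
`D`. -/
theorem leibnizDefect_mem_tFilt (hD : opCoeff D 0 = 0) {m : ℕ}
    (h : ∀ u v, leibnizDefect D 1 u v ∈ tFilt m) (k : ℕ) (u v : FPS c n K⟦X⟧) :
    leibnizDefect D (k + 2) u v ∈ tFilt (m + 1) := by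
  have hstep : ∀ k : ℕ, leibnizDefect D (k + 1) u v ∈ tFilt m →
      leibnizDefect D (k + 2) u v ∈ tFilt (m + 1) := by
    intro k hk
    rw [leibnizDefect_succ]
    refine add_mem (map_mem_tFilt hD hk) (sum_mem fun x hx => nsmul_mem ?_ _)
    have hx' := mem_antidiagonal.mp hx
    obtain ⟨i, j⟩ := x
    rcases i with _ | i
    · obtain rfl : j = k + 1 := by simpa using hx'
      obtain ⟨w, hw⟩ := exists_map_eq_X_smul hD ((D ^ k) v)
      simp only [pow_succ' D k, Module.End.mul_apply, hw]
      rw [leibnizDefect_one_smul_right]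
      exact X_smul_mem_tFilt (h _ _)
    · obtain ⟨w, hw⟩ := exists_map_eq_X_smul hD ((D ^ i) u)
      simp only [pow_succ' D i, Module.End.mul_apply, hw]
      rw [leibnizDefect_one_smul_left]
      exact X_smul_mem_tFilt (h _ _)
  induction k with
  | zero => exact hstep 0 (h u v)
  | succ k ih => exact hstep (k + 1) fun j hj => ih j (by omega)

variable [Algebra ℚ K]

theorem tCoeff_expApply_mul_expApply (hD : opCoeff D 0 = 0) (u v : FPS c n K⟦X⟧) (m : ℕ) :
    tCoeff m (expApply D u * expApply D v) = ∑ k ∈ Finset.range (m + 1),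
      algebraMap ℚ K (1 / (k.factorial : ℚ)) •
        tCoeff m (∑ x ∈ antidiagonal k, k.choose x.1 • ((D ^ x.1) u * (D ^ x.2) v)) := by
  have h1 : ∀ w, ∀ j < m + 1, tCoeff j (expApply D w) = ∑ k ∈ Finset.range (m + 1),
      algebraMap ℚ K (1 / (k.factorial : ℚ)) • tCoeff j ((D ^ k) w) := by
    intro w j hj
    rw [expApply, tCoeff_tSeries]
    refine Finset.sum_subset (Finset.range_mono hj) fun k _ hk => ?_
    rw [pow_map_mem_tFilt hD k w j (by simpa using hk), smul_zero]
  have h2 : ∀ k, algebraMap ℚ K (1 / (k.factorial : ℚ)) •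
      tCoeff m (∑ x ∈ antidiagonal k, k.choose x.1 • ((D ^ x.1) u * (D ^ x.2) v)) =
      ∑ x ∈ antidiagonal k, (algebraMap ℚ K (1 / (x.1.factorial : ℚ)) *
        algebraMap ℚ K (1 / (x.2.factorial : ℚ))) • tCoeff m ((D ^ x.1) u * (D ^ x.2) v) := by
    intro k
    rw [tCoeff_sum, Finset.smul_sum]
    refine Finset.sum_congr rfl fun x hx => ?_
    have h3 : tCoeff m (k.choose x.1 • ((D ^ x.1) u * (D ^ x.2) v)) =
        (k.choose x.1 : K) • tCoeff m ((D ^ x.1) u * (D ^ x.2) v) := by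
      rw [Nat.cast_smul_eq_nsmul]
      exact map_nsmul (tCoeffHom m) _ _
    rw [h3, smul_smul, ← map_natCast (algebraMap ℚ K), ← map_mul, ← map_mul,
      ← mem_antidiagonal.mp hx, Nat.choose_symm_add,
      Nat.add_choose, Nat.cast_div]
    · congr 2
      have := Nat.cast_ne_zero (R := ℚ).mpr (x.1 + x.2).factorial_ne_zero
      push_cast
      field_simp
    · exact Nat.factorial_mul_factorial_dvd_factorial_add _ _
    · exact Nat.cast_ne_zero.mpr (by positivity)
  simp only [h2]
  rw [PowerSeries.sum_range_sum_antidiagonal (fun i j => (algebraMap ℚ K (1 / (i.factorial : ℚ)) *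
    algebraMap ℚ K (1 / (j.factorial : ℚ))) • tCoeff m ((D ^ i) u * (D ^ j) v))]
  · rw [tCoeff_mul]
    simp only [tCoeff_mul, Finset.smul_sum]
    have h4 : ∀ x ∈ antidiagonal m, tCoeff x.1 (expApply D u) * tCoeff x.2 (expApply D v) =
        ∑ i ∈ Finset.range (m + 1), ∑ j ∈ Finset.range (m + 1),
          (algebraMap ℚ K (1 / (i.factorial : ℚ)) * algebraMap ℚ K (1 / (j.factorial : ℚ))) •
            (tCoeff x.1 ((D ^ i) u) * tCoeff x.2 ((D ^ j) v)) := by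
      intro x hx
      have hx' := mem_antidiagonal.mp hx
      rw [h1 u x.1 (by omega), h1 v x.2 (by omega), Finset.sum_mul_sum]
      simp only [smul_mul_smul_comm]
    rw [Finset.sum_congr rfl h4, Finset.sum_comm]
    refine Finset.sum_congr rfl fun i _ => ?_
    exact Finset.sum_comm
  · intro i j hij
    rw [mul_mem_tFilt (pow_map_mem_tFilt hD i u) (pow_map_mem_tFilt hD j v) m hij, smul_zero]

/-- If the exponential of `D` is multiplicative, then `D` is a derivation: the failure of the
Leibniz rule is divisible by every power of `t`, because its lowest term would be the lowest term
of the failure of `exp D` to be multiplicative. -/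
theorem leibniz_of_expApply_mul (hD : opCoeff D 0 = 0)
    (h : ∀ u v, expApply D (u * v) = expApply D u * expApply D v) (u v : FPS c n K⟦X⟧) :
    D (u * v) = D u * v + u * D v := by
  have key : ∀ m : ℕ, ∀ u v, leibnizDefect D 1 u v ∈ tFilt m := by
    intro m
    induction m with
    | zero => intro u v j hj; omega
    | succ m ih =>
      intro u v j hj
      rcases Nat.lt_succ_iff_lt_or_eq.mp hj with hj | rfl
      · exact ih u v j hj
      · have h1 := congrArg (tCoeff j) (h u v)
        rw [tCoeff_expApply_mul_expApply hD, expApply, tCoeff_tSeries, ← sub_eq_zero,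
          ← Finset.sum_sub_distrib] at h1
        simp only [← smul_sub, ← tCoeff_sub] at h1
        change ∑ k ∈ Finset.range (j + 1), algebraMap ℚ K (1 / (k.factorial : ℚ)) •
          tCoeff j (leibnizDefect D k u v) = 0 at h1
        have h0 : leibnizDefect D 0 u v = 0 := by simp [leibnizDefect]
        have h2 : ∀ k, k ≠ 1 → tCoeff j (leibnizDefect D k u v) = 0 := by
          intro k hk
          rcases k with _ | _ | k
          · rw [h0, tCoeff_zero]
          · exact absurd rfl hk
          · exact leibnizDefect_mem_tFilt hD ih k u v j j.lt_succ_self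
        -- in the sum `h1` only the summand with `k = 1` survives, which occurs if `1 ≤ j`
        rcases Nat.eq_zero_or_pos j with rfl | hj
        · have h3 : ∀ w, tCoeff 0 (D w) = 0 := fun w =>
            map_mem_tFilt hD (m := 0) (f := w) (fun j hj => by omega) 0 (by omega)
          rw [leibnizDefect_one, tCoeff_sub, tCoeff_add, tCoeff_mul, tCoeff_mul]
          simp [h3]
        · rw [Finset.sum_eq_single 1] at h1
          · simpa using h1
          · intro k _ hk
            rw [h2 k hk, smul_zero]
          · intro hk
            exact absurd (Finset.mem_range.mpr (by omega)) hk
  refine sub_eq_zero.mp (tExt fun m => ?_)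
  rw [← leibnizDefect_one, key (m + 1) u v m m.lt_succ_self, tCoeff_zero]

end multiplicative

end FPS

/-! ### Coefficients of the series over compositions -/

namespace Compo

open PowerSeries

/-- The logarithm of `g = 1 + ∑ t ^ m g_m` as a sum over compositions. -/
theorem coeff_evalAt_log {K E : Type*} [CommRing K] [Ring E] [Algebra K E] [Algebra ℚ K]
    {g : E⟦X⟧} (hg : constantCoeff g = 1) {m : ℕ} (hm : m ≠ 0) :
    coeff m (evalAt (g - 1) (log K)) = ∑ I ∈ lists m,
      algebraMap ℚ K ((-1) ^ (I.length + 1) / (I.length : ℚ)) •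
        (I.map fun j => coeff j g).prod := by
  rw [coeff_evalAt_eq_sum_lists (by rw [map_sub, hg, map_one, sub_self])]
  refine Finset.sum_congr rfl fun I hI => ?_
  obtain ⟨h1, h2⟩ := mem_lists.mp hI
  have h3 : I.length ≠ 0 := by
    intro h
    rw [List.length_eq_zero_iff.mp h] at h2
    exact hm h2.symm
  rw [coeff_log, if_neg h3]
  congr 2
  refine List.map_congr_left fun j hj => ?_
  rw [map_sub, coeff_one, if_neg (h1 j hj).ne', sub_zero]

theorem prod_map_neg_one_pow_smul {K E : Type*} [CommRing K] [Ring E] [Algebra K E] (w : ℕ → E)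
    (I : List ℕ) : (I.map fun j => (-1 : K) ^ j • w j).prod =
      (-1 : K) ^ I.sum • (I.map w).prod := by
  induction I with
  | nil => simp
  | cons j I ih =>
    rw [List.map_cons, List.prod_cons, ih, List.sum_cons, List.map_cons, List.prod_cons, pow_add,
      smul_mul_smul_comm]

theorem tCoeff_series {c : VarKind} {n : ℕ} {K : Type u} [CommRing K] [Algebra ℚ K]
    {q : (k : ℕ) → Composition k → ℚ} (w : ℕ → Module.End K (FPS c n K)) (i : Fin n) {m : ℕ}
    (hm : m ≠ 0) (q' : List ℕ → ℚ) (hq : ∀ I : Composition m, q m I = q' I.blocks) :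
    FPS.tCoeff m (series q w i) =
      (∑ I ∈ lists m, algebraMap ℚ K (q' I) • (I.map w).prod) (FPS.X i) := by
  rw [series, FPS.tCoeff_tSeries, if_neg hm, ← sum_composition, LinearMap.sum_apply]
  simp only [hq, LinearMap.smul_apply]

theorem tCoeff_zero_series {c : VarKind} {n : ℕ} {K : Type u} [CommRing K] [Algebra ℚ K]
    (q : (k : ℕ) → Composition k → ℚ) (w : ℕ → Module.End K (FPS c n K)) (i : Fin n) :
    FPS.tCoeff 0 (series q w i) = 0 := by
  rw [series, FPS.tCoeff_tSeries, if_pos rfl]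

open Classical in
theorem coarserSum_eq {m : ℕ} (I : Composition m) {q : Composition m → ℚ} (q' : List ℕ → ℚ)
    (hq : ∀ J : Composition m, q J = q' J.blocks) :
    coarserSum I q = ∑ J ∈ (lists m).filter (Refines I.blocks), q' J := by
  rw [coarserSum, Finset.sum_filter, Finset.sum_filter, ← sum_composition]
  simp only [hq]

end Compo

namespace FAut

open FPS
open Finset.HasAntidiagonal (antidiagonal)

variable {c : VarKind} {n : ℕ} {K : Type u} [CommRing K]

/-! ### The differential equations of an automorphism and its inverse -/

theorem tDeriv_X (i : Fin n) : tDeriv (X i : FPS c n K⟦X⟧) = 0 := by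
  rw [← tConst_X, tDeriv_tConst]

/-- The chain rule for `∂/∂t`: conjugating `∂/∂t` by an automorphism changes it by a
`K[[t]]`-linear derivation, which is determined by its values on the variables. -/
theorem tDeriv_apply (Φ : FAut c n K) (u : FPS c n K⟦X⟧) : tDeriv (Φ u) =
    Φ (tDeriv u + der (fun i => Φ.symm (tDeriv (Φ (X i)))) u) := by
  let D : Module.End K⟦X⟧ (FPS c n K⟦X⟧) :=
    { toFun := fun u => Φ.symm (tDeriv (Φ u)) - tDeriv u
      map_add' := fun u v => by
        simp only [map_add, tDeriv_add]
        abel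
      map_smul' := fun r u => by
        simp only [map_smul, tDeriv_smul, map_add, AlgEquiv.symm_apply_apply, RingHom.id_apply,
          smul_sub]
        abel }
  have hD : D = der fun i => Φ.symm (tDeriv (Φ (X i))) := by
    refine eq_of_leibniz (fun u v => ?_) (der_leibniz _) fun i => ?_
    · change Φ.symm (tDeriv (Φ (u * v))) - tDeriv (u * v) =
        (Φ.symm (tDeriv (Φ u)) - tDeriv u) * v + u * (Φ.symm (tDeriv (Φ v)) - tDeriv v)
      simp only [map_mul, tDeriv_mul, map_add, AlgEquiv.symm_apply_apply, sub_mul, mul_sub]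
      abel
    · change Φ.symm (tDeriv (Φ (X i))) - tDeriv (X i) = _
      rw [tDeriv_X, sub_zero, der_X]
  rw [← hD]
  change tDeriv (Φ u) = Φ (tDeriv u + (Φ.symm (tDeriv (Φ u)) - tDeriv u))
  rw [add_sub_cancel, AlgEquiv.apply_symm_apply]

/-- `∂/∂t G_t = G_t h(t)`. -/
theorem tDeriv_symm_tConst (F : FAut c n K) (u : FPS c n K) :
    tDeriv (F.symm (tConst u)) = F.symm (F.h (tConst u)) := by
  have h : ∀ i, tDeriv (F.M i) = tDeriv (F.symm (X i)) := fun i => by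
    rw [M, sub_eq_add_neg, tDeriv_add, tDeriv_neg, tDeriv_X, neg_zero, add_zero]
  rw [tDeriv_apply, tDeriv_tConst, zero_add, FAut.h]
  simp only [h]
  rfl

/-- `∂/∂t G_t = m(t) G_t`. -/
theorem tDeriv_symm_tConst' (F : FAut c n K) (u : FPS c n K) :
    tDeriv (F.symm (tConst u)) = F.m (F.symm (tConst u)) := by
  have h : ∀ i, F.symm (tDeriv (F.H i)) = -F.symm (tDeriv (F (X i))) := fun i => by
    rw [H, sub_eq_add_neg, tDeriv_add, tDeriv_neg, tDeriv_X, zero_add, map_neg]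
  have hm : F.m = -der fun i => F.symm (tDeriv (F (X i))) := by
    refine eq_of_leibniz (der_leibniz _) (fun u v => ?_) fun i => ?_
    · simp only [LinearMap.neg_apply, der_leibniz]
      rw [neg_mul, mul_neg, neg_add]
    · rw [FAut.m, der_X, LinearMap.neg_apply, der_X, h]
  have h1 := tDeriv_apply F (F.symm (tConst u))
  rw [AlgEquiv.apply_symm_apply, tDeriv_tConst, eq_comm, map_eq_zero_iff _ F.injective] at h1
  rw [hm, LinearMap.neg_apply]
  exact eq_neg_of_add_eq_zero_left h1

theorem s_succ_eq_sum_psi (F : FAut c n K) (m : ℕ) : ((m + 1 : ℕ) : K) • F.s (m + 1) =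
    ∑ x ∈ antidiagonal m, F.s x.2 * F.psi (x.1 + 1) := by
  have h : ((m + 1 : ℕ) : K) • F.s (m + 1) = opCoeff (F.symm.toLinearMap * F.h) m := by
    refine LinearMap.ext fun u => ?_
    rw [LinearMap.smul_apply, s, opCoeff_apply, ← tCoeff_tDeriv, opCoeff_apply]
    exact congrArg _ (F.tDeriv_symm_tConst u)
  rw [h, opCoeff_mul, ← Finset.Nat.sum_antidiagonal_swap]
  rfl

theorem s_succ_eq_sum_xi (F : FAut c n K) (m : ℕ) : ((m + 1 : ℕ) : K) • F.s (m + 1) =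
    ∑ x ∈ antidiagonal m, F.xi (x.1 + 1) * F.s x.2 := by
  have h : ((m + 1 : ℕ) : K) • F.s (m + 1) = opCoeff (F.m * F.symm.toLinearMap) m := by
    refine LinearMap.ext fun u => ?_
    rw [LinearMap.smul_apply, s, opCoeff_apply, ← tCoeff_tDeriv, opCoeff_apply]
    exact congrArg _ (F.tDeriv_symm_tConst' u)
  rw [h, opCoeff_mul]
  rfl

theorem opSeries_mul_opSeries_symm (F : FAut c n K) :
    opSeries F.toLinearMap * opSeries F.symm.toLinearMap = 1 := by
  rw [← map_mul, ← map_one opSeries]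
  congr 1
  exact LinearMap.ext fun u => F.apply_symm_apply u

theorem opSeries_symm_mul_opSeries (F : FAut c n K) :
    opSeries F.symm.toLinearMap * opSeries F.toLinearMap = 1 := by
  rw [← map_mul, ← map_one opSeries]
  congr 1
  exact LinearMap.ext fun u => F.symm_apply_apply u

/-- `F_t` is the identity at `t = 0`. -/
theorem opCoeff_zero_eq_one {F : FAut c n K} (hF : ∀ i, tCoeff 0 (F.H i) = 0) :
    opCoeff F.toLinearMap 0 = 1 := by
  refine eq_one_of_map_mul ?_ (fun u v => ?_) fun i => ?_
  · rw [opCoeff_apply, tConst_one, AlgEquiv.toLinearMap_apply, map_one, ← tConst_one,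
      tCoeff_zero_tConst]
  · simp only [opCoeff_apply, tConst_mul, AlgEquiv.toLinearMap_apply, map_mul]
    simp [tCoeff_mul]
  · rw [opCoeff_apply, tConst_X, AlgEquiv.toLinearMap_apply]
    have h := hF i
    rw [H, tCoeff_sub, ← tConst_X, tCoeff_zero_tConst, tConst_X, sub_eq_zero] at h
    exact h.symm

theorem s_zero {F : FAut c n K} (hF : ∀ i, tCoeff 0 (F.H i) = 0) : F.s 0 = 1 := by
  have h := congrArg PowerSeries.constantCoeff F.opSeries_mul_opSeries_symm
  rwa [map_mul, constantCoeff_opSeries, opCoeff_zero_eq_one hF, one_mul, constantCoeff_opSeries,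
    map_one] at h

/-! ### The D-Log -/

theorem opCoeff_neg_der_X (a : Fin n → FPS c n K⟦X⟧) (m : ℕ) (i : Fin n) :
    opCoeff (-der a) m (X i) = -tCoeff m (a i) := by
  rw [opCoeff_apply, tConst_X, LinearMap.neg_apply, der_X, tCoeff_neg]

theorem opCoeff_neg_der_zero {a : Fin n → FPS c n K⟦X⟧} (ha : ∀ i, tCoeff 0 (a i) = 0) :
    opCoeff (-der a) 0 = 0 := by
  refine eq_of_leibniz (fun u v => ?_) (fun u v => by simp) fun i => ?_
  · rw [opCoeff_apply, tConst_mul, LinearMap.neg_apply, der_leibniz, neg_add, tCoeff_add,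
      ← neg_mul, tCoeff_mul_tConst, ← mul_neg, tCoeff_tConst_mul]
    rfl
  · rw [opCoeff_neg_der_X, ha, neg_zero, LinearMap.zero_apply]

variable [Algebra ℚ K]

theorem isDLog_iff (F : FAut c n K) (a : Fin n → FPS c n K⟦X⟧) :
    F.IsDLog a ↔ (∀ i, tCoeff 0 (a i) = 0) ∧
      PowerSeries.evalAt (opSeries (-der a)) (PowerSeries.exp K) =
        opSeries F.symm.toLinearMap :=
  and_congr_right fun ha => forall_expApply_eq_iff (P := F.symm.toLinearMap)
    (opCoeff_neg_der_zero ha)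

/-- `d(t)` is the logarithm of `u ↦ u(G_t)`. -/
theorem IsDLog.opSeries_eq {F : FAut c n K} {a : Fin n → FPS c n K⟦X⟧} (h : F.IsDLog a) :
    opSeries (-der a) =
      PowerSeries.evalAt (opSeries F.symm.toLinearMap - 1) (PowerSeries.log K) := by
  rw [isDLog_iff] at h
  rw [← h.2, PowerSeries.evalAt_log_exp_sub_one]
  rw [constantCoeff_opSeries, opCoeff_neg_der_zero h.1]

/-- As `e ^ (-d(t))` is the inverse of `e ^ d(t)`, the operator `-d(t)` is the logarithm of
`u ↦ u(F_t)`. -/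
theorem IsDLog.opSeries_neg_eq {F : FAut c n K} {a : Fin n → FPS c n K⟦X⟧} (h : F.IsDLog a) :
    -opSeries (-der a) =
      PowerSeries.evalAt (opSeries F.toLinearMap - 1) (PowerSeries.log K) := by
  rw [isDLog_iff] at h
  have h0 : PowerSeries.constantCoeff (opSeries (-der a)) = 0 := by
    rw [constantCoeff_opSeries, opCoeff_neg_der_zero h.1]
  -- `exp (-d) * G = 1`, so that `exp (-d) = F`
  have h1 := PowerSeries.evalAt_neg_exp_mul (K := K) h0
  rw [h.2] at h1
  have h2 : PowerSeries.evalAt (-opSeries (-der a)) (PowerSeries.exp K) =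
      opSeries F.toLinearMap :=
    left_inv_eq_right_inv h1 F.opSeries_symm_mul_opSeries
  rw [← h2, PowerSeries.evalAt_log_exp_sub_one]
  rw [map_neg, h0, neg_zero]

/-- The logarithm `D` of `u ↦ u(G_t)` has a multiplicative exponential, hence is a derivation, and
so is of the form `-[a ∂/∂z]`. -/
theorem existsUnique_isDLog {F : FAut c n K} (hF : ∀ i, tCoeff 0 (F.H i) = 0) :
    ∃! a, F.IsDLog a := by
  have hs : PowerSeries.constantCoeff (opSeries F.symm.toLinearMap - 1) = 0 := by
    rw [map_sub, constantCoeff_opSeries, map_one, sub_eq_zero]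
    exact s_zero hF
  let D : Module.End K⟦X⟧ (FPS c n K⟦X⟧) := opSeries.symm
    (PowerSeries.evalAt (opSeries F.symm.toLinearMap - 1) (PowerSeries.log K))
  have hopD : opSeries D = PowerSeries.evalAt (opSeries F.symm.toLinearMap - 1)
    (PowerSeries.log K) := opSeries.apply_symm_apply _
  have hD0 : opCoeff D 0 = 0 := by
    rw [← constantCoeff_opSeries, hopD, PowerSeries.constantCoeff_evalAt_log]
  have hexp : PowerSeries.evalAt (opSeries D) (PowerSeries.exp K) =
      opSeries F.symm.toLinearMap := by
    rw [hopD, PowerSeries.evalAt_exp_log hs, add_sub_cancel]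
  have hexp' : ∀ u, expApply D u = F.symm u := (forall_expApply_eq_iff hD0).mpr hexp
  have hD : ∀ u v, D (u * v) = D u * v + u * D v :=
    leibniz_of_expApply_mul hD0 fun u v => by simp only [hexp', map_mul]
  have hder : -der (fun i => -D (X i)) = D := by
    refine eq_of_leibniz (fun u v => ?_) hD fun i => ?_
    · simp only [LinearMap.neg_apply, der_leibniz]
      rw [neg_mul, mul_neg, neg_add]
    · rw [LinearMap.neg_apply, der_X, neg_neg]
  refine ⟨fun i => -D (X i), (F.isDLog_iff _).mpr ⟨fun i => ?_, by rw [hder, hexp]⟩, ?_⟩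
  · rw [tCoeff_neg, ← tConst_X, ← opCoeff_apply, hD0, LinearMap.zero_apply, neg_zero]
  · intro a ha
    have h1 : -der a = D := opSeries.injective (by rw [ha.opSeries_eq, hopD])
    funext i
    rw [← h1, LinearMap.neg_apply, der_X, neg_neg]

open Compo

theorem IsDLog.tCoeff_eq_sum_s {F : FAut c n K} (hF : ∀ i, tCoeff 0 (F.H i) = 0)
    {a : Fin n → FPS c n K⟦X⟧} (h : F.IsDLog a) (i : Fin n) {m : ℕ} (hm : m ≠ 0) :
    tCoeff m (a i) = (∑ J ∈ lists m, algebraMap ℚ K ((-1) ^ J.length / (J.length : ℚ)) •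
      (J.map F.s).prod) (X i) := by
  have hs : PowerSeries.constantCoeff (opSeries F.symm.toLinearMap) = 1 := by
    rw [constantCoeff_opSeries]
    exact s_zero hF
  have h1 : tCoeff m (a i) = (-opCoeff (-der a) m) (X i) := by
    rw [LinearMap.neg_apply, opCoeff_neg_der_X, neg_neg]
  rw [h1, ← coeff_opSeries, h.opSeries_eq, coeff_evalAt_log hs hm, ← Finset.sum_neg_distrib]
  simp only [coeff_opSeries]
  refine congrArg (fun P : Module.End K (FPS c n K) => P (X i)) ?_
  refine Finset.sum_congr rfl fun J _ => ?_
  rw [← neg_smul, ← map_neg, pow_succ, mul_neg_one, neg_div, neg_neg]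
  rfl

theorem IsDLog.tCoeff_eq_sum_lam {F : FAut c n K} (hF : ∀ i, tCoeff 0 (F.H i) = 0)
    {a : Fin n → FPS c n K⟦X⟧} (h : F.IsDLog a) (i : Fin n) {m : ℕ} (hm : m ≠ 0) :
    tCoeff m (a i) = (∑ I ∈ lists m,
      algebraMap ℚ K ((-1) ^ ((I.length : ℤ) - (m : ℤ) + 1) / (I.length : ℚ)) •
        (I.map F.lam).prod) (X i) := by
  have hs : PowerSeries.constantCoeff (opSeries F.toLinearMap) = 1 := by
    rw [constantCoeff_opSeries, opCoeff_zero_eq_one hF]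
  have hlam : ∀ j, opCoeff F.toLinearMap j = (-1 : K) ^ j • F.lam j := fun j => by
    rw [lam, smul_smul, ← mul_pow, neg_one_mul, neg_neg, one_pow, one_smul]
  have h1 : tCoeff m (a i) = (-opCoeff (-der a) m) (X i) := by
    rw [LinearMap.neg_apply, opCoeff_neg_der_X, neg_neg]
  rw [h1, ← coeff_opSeries, ← map_neg, h.opSeries_neg_eq, coeff_evalAt_log hs hm]
  simp only [coeff_opSeries, hlam]
  refine congrArg (fun P : Module.End K (FPS c n K) => P (X i)) ?_
  refine Finset.sum_congr rfl fun I hI => ?_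
  have hpow : (-1 : K) ^ m = algebraMap ℚ K ((-1) ^ m) := by simp
  rw [prod_map_neg_one_pow_smul F.lam I, (mem_lists.mp hI).2, hpow, smul_smul, ← map_mul]
  congr 2
  have h2 : ((-1 : ℚ) ^ ((I.length : ℤ) - (m : ℤ) + 1)) = (-1) ^ (I.length + 1) * (-1) ^ m := by
    rw [show (I.length : ℤ) - m + 1 = ((I.length + 1 : ℕ) : ℤ) - (m : ℤ) by push_cast; ring,
      zpow_sub₀ (by norm_num), zpow_natCast, zpow_natCast, div_eq_mul_inv, ← inv_pow]
    norm_num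
  rw [h2, mul_div_right_comm]

end FAut

theorem mainTheorem3 {K : Type u} [CommRing K] [Algebra ℚ K] (c : VarKind) (n : ℕ) (α : ℕ)
    (hα : 1 ≤ α) (F : FAut c n K) (hF : F.IsOfClass α) :
    (∃! a : Fin n → FPS c n K⟦X⟧, F.IsDLog a) ∧
    ∀ a : Fin n → FPS c n K⟦X⟧, F.IsDLog a →
      (∀ i, a i = Compo.series (fun k I =>
        (-1 : ℚ) ^ ((I.length : ℤ) - (k : ℤ) + 1) / (I.length : ℚ)) F.lam i) ∧
      (∀ i, a i = Compo.series (fun _ I => (-1 : ℚ) ^ I.length / (I.length : ℚ)) F.s i) ∧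
      (∀ i, a i = Compo.series (fun _ I => Compo.coarserSum I fun J =>
        (-1 : ℚ) ^ J.length / ((Compo.piU₂ I.blocks J.blocks : ℚ) * (J.length : ℚ))) F.psi i) ∧
      (∀ i, a i = Compo.series (fun _ I => Compo.coarserSum I fun J =>
        (-1 : ℚ) ^ J.length /
          ((Compo.piU₂ I.reverse.blocks J.reverse.blocks : ℚ) * (J.length : ℚ))) F.xi i) := by
  classical
  refine ⟨FAut.existsUnique_isDLog hF.2, fun a ha => ?_⟩
  have heq : ∀ (q : (k : ℕ) → Composition k → ℚ) (w : ℕ → Module.End K (FPS c n K)) (i : Fin n),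
      (∀ m, m ≠ 0 → FPS.tCoeff m (a i) = FPS.tCoeff m (Compo.series q w i)) →
        a i = Compo.series q w i := by
    refine fun q w i h => FPS.tExt fun m => ?_
    rcases eq_or_ne m 0 with rfl | hm
    · rw [ha.1 i, Compo.tCoeff_zero_series]
    · exact h m hm
  refine ⟨fun i => heq _ _ i fun m hm => ?_, fun i => heq _ _ i fun m hm => ?_,
    fun i => heq _ _ i fun m hm => ?_, fun i => heq _ _ i fun m hm => ?_⟩
  · rw [ha.tCoeff_eq_sum_lam hF.2 i hm, Compo.tCoeff_series _ _ hm (fun I =>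
      (-1 : ℚ) ^ ((I.length : ℤ) - (m : ℤ) + 1) / (I.length : ℚ)) fun I => rfl]
  · rw [ha.tCoeff_eq_sum_s hF.2 i hm, Compo.tCoeff_series _ _ hm (fun I =>
      (-1 : ℚ) ^ I.length / (I.length : ℚ)) fun I => rfl]
  · rw [ha.tCoeff_eq_sum_s hF.2 i hm, Compo.sum_prod_map_eq_sum_refines _
      (Compo.eq_sum_lists_of_deriv_eq_mul_right (FAut.s_zero hF.2) F.s_succ_eq_sum_psi)]
    refine (Compo.tCoeff_series _ _ hm _ fun I => ?_).symm
    refine (Compo.coarserSum_eq I (fun J => (-1 : ℚ) ^ J.length /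
      ((Compo.piU₂ I.blocks J : ℚ) * (J.length : ℚ))) fun J => rfl).trans ?_
    refine Finset.sum_congr rfl fun J _ => ?_
    rw [Compo.prod_map_pieces_one_div_piU, div_mul_div_comm, mul_one, mul_comm (J.length : ℚ)]
  · rw [ha.tCoeff_eq_sum_s hF.2 i hm, Compo.sum_prod_map_eq_sum_refines _
      (Compo.eq_sum_lists_of_deriv_eq_mul_left (FAut.s_zero hF.2) F.s_succ_eq_sum_xi)]
    refine (Compo.tCoeff_series _ _ hm _ fun I => ?_).symm
    refine (Compo.coarserSum_eq I (fun J => (-1 : ℚ) ^ J.length /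
      ((Compo.piU₂ I.blocks.reverse J.reverse : ℚ) * (J.length : ℚ))) fun J => rfl).trans ?_
    refine Finset.sum_congr rfl fun J hJ => ?_
    rw [Compo.prod_map_pieces_one_div_piU_reverse (fun x hx => I.blocks_pos hx)
      (Finset.mem_filter.mp hJ).2, div_mul_div_comm, mul_one, mul_comm (J.length : ℚ)]
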